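/- Let $m\ge 1$. For a Schwartz function $\psi$ on $\mathbb R$ let $(-\Delta)^{1/4}\psi$ be the function with Fourier transform $|\xi|^{1/2}\hat\psi$. Let $\dot H^{1/2}(\mathbb R)$ be the space of real functions $f\in L^1_{\rm loc}(\mathbb R)$ such that $f\,(-\Delta)^{1/4}\psi\in L^1(\mathbb R)$ for all Schwartz $\psi$ and such that there is $g=:(-\Delta)^{1/4}f\in L^2(\mathbb R)$ (unique a.e.) with $\int_{\mathbb R} f\,(-\Delta)^{1/4}\psi\,dx=\int_{\mathbb R} g\,\psi\,dx$ for all Schwartz $\psi$ (that is, $\widehat{(-\Delta)^{1/4}f}=|\xi|^{1/2}\hat f$). Let $\dot H^{1/2}(\mathbb R,\mathcal S^{m-1})$ be the set of maps $u=(u_1,\dots,u_m):\mathbb R\to\mathbb R^m$ with all $u_i\in\dot H^{1/2}(\mathbb R)$ and $|u(x)|=1$ for a.e. $x$. For $f,v\in\dot H^{1/2}(\mathbb R)$ put $\langle(-\Delta)^{1/2}f,v\rangle=\int_{\mathbb R}(-\Delta)^{1/4}f\,(-\Delta)^{1/4}v\,dx$, and for $u\in\dot H^{1/2}(\mathbb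 R,\mathcal S^{m-1})$ let $u\wedge(-\Delta)^{1/2}u$ be the distribution with components $$\varphi\mapsto\langle(-\Delta)^{1/2}u_j,\,u_i\varphi\rangle-\langle(-\Delta)^{1/2}u_i,\,u_j\varphi\rangle,\qquad \varphi\in C_c^\infty(\mathbb R),\quad 1\le i,j\le m.$$ **Proposition (singular point removability).** Let $u\in\dot H^{1/2}(\mathbb R,\mathcal S^{m-1})$ and let $\{a_1,\dots,a_\ell\}\subset\mathbb R$ be a finite set. Suppose that $u$ is a $1/2$-harmonic map in $\mathcal D'(\mathbb R\setminus\{a_1,\dots,a_\ell\})$, that is, $$u\wedge(-\Delta)^{1/2}u=0\quad\text{in }\mathcal D'(\mathbb R\setminus\{a_1,\dots,a_\ell\}).$$ Then $u_i\varphi\in\dot H^{1/2}(\mathbb R)$ for all $i$ and all $\varphi\in C_c^\infty(\mathbb R)$ (so that $u\wedge(-\Delta)^{1/2}u$ is well defined on all of $C_c^\infty(\mathbb R)$), and $$u\wedge(-\Delta)^{1/2}u=0\quad\text{in }\mathcal D'(\mathbb R).$$ -/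

import Mathlib

open MeasureTheory TopologicalSpace
open scoped FourierTransform SchwartzMap Distributions

noncomputable section

namespace HalfHarmonic

/-- The function `(-Δ)^{1/4} ψ` for a Schwartz function `ψ` on the line: the Fourier multiplier with
symbol `|ξ|^{1/2}` in the angular frequency, that is `(2π|ξ|)^{1/2}` in Mathlib's normalization
`𝓕 ψ ξ = ∫ exp (-2πi x ξ) ψ x dx`. -/
def quarterLaplacianSchwartz (ψ : 𝓢(ℝ, ℂ)) : ℝ → ℂ :=
  𝓕⁻ (fun ξ : ℝ => (((2 * Real.pi * |ξ|) ^ (1 / 2 : ℝ) : ℝ) : ℂ) * 𝓕 (ψ : ℝ → ℂ) ξ)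

/-- `g ∈ L²(ℝ)` is `(-Δ)^{1/4} f`, i.e. the Fourier transform of `g` is `|ξ|^{1/2}` times that of
`f`. As `f` need not be in `L²` (constants are allowed) and the symbol is not smooth at `0`, this is
expressed by transposition: `⟨f, (-Δ)^{1/4} ψ⟩ = ⟨g, ψ⟩` for all Schwartz functions `ψ`, where
the pairing on the left is required to converge absolutely. (Since `(-Δ)^{1/4} ψ` is
`O(|x|^{-3/2})` at infinity, it does so for every bounded measurable `f`.) -/
structure IsQuarterLaplacian (f g : ℝ → ℝ) : Prop where
  locallyIntegrable : LocallyIntegrable f volume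
  memLp : MemLp g 2 volume
  integrable : ∀ ψ : 𝓢(ℝ, ℂ),
    Integrable (fun x => (f x : ℂ) * quarterLaplacianSchwartz ψ x) volume
  integral_eq : ∀ ψ : 𝓢(ℝ, ℂ),
    ∫ x, (f x : ℂ) * quarterLaplacianSchwartz ψ x = ∫ x, (g x : ℂ) * ψ x

/-- The homogeneous space of real functions `f` on the line with `(-Δ)^{1/4} f ∈ L²(ℝ)`. -/
def MemHomHalf (f : ℝ → ℝ) : Prop := ∃ g : ℝ → ℝ, IsQuarterLaplacian f g

open Classical in
/-- A representative of the (almost everywhere unique) function `(-Δ)^{1/4} f ∈ L²(ℝ)`, for `f` in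
the homogeneous space of order `1/2`; the value is `0` for other `f`. -/
def quarterLaplacian (f : ℝ → ℝ) : ℝ → ℝ :=
  if h : MemHomHalf f then h.choose else 0

/-- Maps of finite energy from the line to the unit sphere of `ℝᵐ`. -/
structure MemHomHalfSphere {m : ℕ} (u : ℝ → EuclideanSpace ℝ (Fin m)) : Prop where
  memHomHalf : ∀ i, MemHomHalf (fun x => u x i)
  mem_sphere : ∀ᵐ x, u x ∈ Metric.sphere (0 : EuclideanSpace ℝ (Fin m)) 1

/-- The distribution `(-Δ)^{1/2} f`, for `f` in the homogeneous space of order `1/2`, as a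
functional on functions `v` of that same space:
`⟨(-Δ)^{1/2} f, v⟩ = ∫ (-Δ)^{1/4} f (-Δ)^{1/4} v`. -/
def halfLaplacian (f v : ℝ → ℝ) : ℝ :=
  ∫ x, quarterLaplacian f x * quarterLaplacian v x

/-- The component `(i, j)` of `u ∧ (-Δ)^{1/2} u`, that is
`u_i (-Δ)^{1/2} u_j - u_j (-Δ)^{1/2} u_i`, evaluated at a test function `φ`. The product of the
function `u_i` with the distribution `(-Δ)^{1/2} u_j` is `φ ↦ ⟨(-Δ)^{1/2} u_j, u_i φ⟩`. -/
def wedgeHalfLaplacian {m : ℕ} (u : ℝ → EuclideanSpace ℝ (Fin m)) (i j : Fin m)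
    (φ : ℝ → ℝ) : ℝ :=
  halfLaplacian (fun x => u x j) (fun x => u x i * φ x) -
    halfLaplacian (fun x => u x i) (fun x => u x j * φ x)

/-- `u ∧ (-Δ)^{1/2} u = 0` in the sense of distributions on the open set `Ω`. -/
def IsHalfHarmonicOn {m : ℕ} (u : ℝ → EuclideanSpace ℝ (Fin m)) (Ω : Opens ℝ) : Prop :=
  ∀ φ : 𝓓(Ω, ℝ), ∀ i j : Fin m, wedgeHalfLaplacian u i j φ = 0

/-- The line with finitely many points removed. -/
def puncturedLine (A : Finset ℝ) : Opens ℝ :=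
  ⟨(A : Set ℝ)ᶜ, A.finite_toSet.isClosed.isOpen_compl⟩

end HalfHarmonic

end

/-!
A bounded `f` with `(-Δ)^{1/4} f = g ∈ L²` has increments `f (· + h) - f` in `L²`, with Fourier
transform `(e^{2πihξ} - 1) / (2π|ξ|)^{1/2} · 𝓕 g`; since only the pairing of `f` with
`(-Δ)^{1/4}` of Schwartz functions is given, this is obtained by cutting the symbol off near `0`
and infinity and passing to the limit. By Plancherel the Gagliardo seminorm of `f` is then a
constant multiple of `‖g‖²`. Conversely, a function in `L¹ ∩ L²` with finite Gagliardo seminorm has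
its quarter Laplacian in `L²`.

The Gagliardo seminorm satisfies a Leibniz bound on bounded functions, so `u_i φ` has finite
energy, and it is invariant under dilations, so multiplying `φ` by cutoffs that vanish on shrinking
neighbourhoods of the singular points keeps the energies of the products with `u_i` bounded. Hence
`(-Δ)^{1/4} (u_i φ_n)` converges weakly in `L²` to `(-Δ)^{1/4} (u_i φ)`, and
`u ∧ (-Δ)^{1/2} u`, which vanishes on every `φ_n`, vanishes on `φ`.
-/

namespace HalfHarmonic

open Filter Topology
open scoped ENNReal ContDiff ComplexConjugate

section SquareIntegrable

variable {α E : Type*} {mα : MeasurableSpace α} {μ : Measure α} [NormedAddCommGroup E]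

lemma eLpNorm_two_sq (f : α → E) : eLpNorm f 2 μ ^ 2 = ∫⁻ x, ‖f x‖ₑ ^ 2 ∂μ := by
  simpa using eLpNorm_nnreal_pow_eq_lintegral (μ := μ) (f := f) (p := 2) (by norm_num)

lemma memLp_two_iff_lintegral_ne_top {f : α → E} (hf : AEStronglyMeasurable f μ) :
    MemLp f 2 μ ↔ ∫⁻ x, ‖f x‖ₑ ^ 2 ∂μ ≠ ⊤ := by
  rw [← eLpNorm_two_sq, ENNReal.pow_ne_top_iff, MemLp, lt_top_iff_ne_top]
  simp [hf]

lemma enorm_Lp_two_sq (G : Lp E 2 μ) : ‖G‖ₑ ^ 2 = ∫⁻ x, ‖G x‖ₑ ^ 2 ∂μ := by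
  rw [Lp.enorm_def, eLpNorm_two_sq]

lemma enorm_toLp_two_sq {f : α → E} (hf : MemLp f 2 μ) :
    ‖hf.toLp f‖ₑ ^ 2 = ∫⁻ x, ‖f x‖ₑ ^ 2 ∂μ := by
  rw [Lp.enorm_toLp, eLpNorm_two_sq]

lemma enorm_ofReal (r : ℝ) : ‖(r : ℂ)‖ₑ = ‖r‖ₑ := by
  rw [← ofReal_norm, Complex.norm_real, ofReal_norm]

lemma tendsto_lintegral_enorm_sq_zero {F : ℕ → α → E} (hF : ∀ n, AEStronglyMeasurable (F n) μ)
    {b : α → ℝ} (hb : MemLp b 2 μ) (hFb : ∀ n, ∀ᵐ x ∂μ, ‖F n x‖ ≤ b x)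
    (hlim : ∀ᵐ x ∂μ, ∀ᶠ n in atTop, F n x = 0) :
    Tendsto (fun n => ∫⁻ x, ‖F n x‖ₑ ^ 2 ∂μ) atTop (𝓝 0) := by
  rw [← lintegral_zero (α := α) (μ := μ)]
  refine tendsto_lintegral_of_dominated_convergence' (fun x => ‖b x‖ₑ ^ 2)
    (fun n => (hF n).enorm.pow_const 2) (fun n => ?_)
    ((memLp_two_iff_lintegral_ne_top hb.1).1 hb) ?_
  · filter_upwards [hFb n] with x hx
    gcongr
    rw [enorm_le_iff_norm_le]
    exact hx.trans (le_abs_self _)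
  · filter_upwards [hlim] with x hx
    refine tendsto_const_nhds.congr' ?_
    filter_upwards [hx] with n hn
    simp [hn]

end SquareIntegrable

section Plancherel

variable {V : Type*} [NormedAddCommGroup V] [InnerProductSpace ℝ V] [FiniteDimensional ℝ V]
  [MeasurableSpace V] [BorelSpace V]

lemma ae_eq_of_integral_mul_schwartz {F F' : V → ℂ} (hF : LocallyIntegrable F)
    (hF' : LocallyIntegrable F')
    (h : ∀ q : 𝓢(V, ℂ), (∀ x, conj (q x) = q x) → ∫ x, F x * q x = ∫ x, F' x * q x) :
    F =ᵐ[volume] F' := by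
  refine ae_eq_of_integral_contDiff_smul_eq hF hF' fun χ hχ hχc => ?_
  have hc : HasCompactSupport (fun x => (χ x : ℂ)) := hχc.comp_left Complex.ofReal_zero
  simp only [Complex.real_smul, mul_comm (Complex.ofReal _)]
  exact h (hc.toSchwartzMap (Complex.ofRealCLM.contDiff.comp hχ)) fun x => Complex.conj_ofReal _

lemma continuous_fourier {f : V → ℂ} (hf : Integrable f) : Continuous (𝓕 f) :=
  VectorFourier.fourierIntegral_continuous Real.continuous_fourierChar
    (innerSL ℝ).continuous₂ hf

lemma integral_fourier_mul {f w : V → ℂ} (hf : Integrable f) (hw : Integrable w) :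
    ∫ ξ, 𝓕 f ξ * w ξ = ∫ x, f x * 𝓕 w x := by
  simpa using! VectorFourier.integral_fourierIntegral_smul_eq_flip (L := innerₗ V)
    Real.continuous_fourierChar continuous_inner hf hw

lemma integral_fourier_Lp_mul (G : Lp ℂ 2 (volume : Measure V)) (q : 𝓢(V, ℂ)) :
    ∫ ξ, 𝓕 G ξ * q ξ = ∫ x, G x * (𝓕 q) x := by
  have h := congrArg (fun T : 𝓢'(V, ℂ) => T q) (Lp.fourier_toTemperedDistribution_eq G)
  simp only [TemperedDistribution.fourier_apply, Lp.toTemperedDistribution_apply,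
    smul_eq_mul] at h
  simpa only [mul_comm] using h.symm

lemma integral_fourier_Lp_mul_fourierInv (G : Lp ℂ 2 (volume : Measure V)) (q : 𝓢(V, ℂ)) :
    ∫ ξ, 𝓕 G ξ * (𝓕⁻ q) ξ = ∫ x, G x * q x := by
  rw [integral_fourier_Lp_mul, FourierTransform.fourier_fourierInv_eq]

lemma fourier_toLp_ae_eq {f : V → ℂ} (hf : Integrable f) (hf2 : MemLp f 2) :
    (𝓕 (hf2.toLp f) : Lp ℂ 2 (volume : Measure V)) =ᵐ[volume] 𝓕 f := by
  refine ae_eq_of_integral_mul_schwartz ((Lp.memLp _).locallyIntegrable one_le_two)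
    (continuous_fourier hf).locallyIntegrable fun q _ => ?_
  rw [integral_fourier_Lp_mul, integral_fourier_mul hf q.integrable]
  refine integral_congr_ae ?_
  filter_upwards [hf2.coeFn_toLp] with x hx
  rw [hx, SchwartzMap.fourier_coe]

lemma enorm_fourier_Lp (G : Lp ℂ 2 (volume : Measure V)) : ‖𝓕 G‖ₑ = ‖G‖ₑ := by
  simp only [← ofReal_norm, Lp.norm_fourier_eq]

lemma lintegral_enorm_fourier_sq {f : V → ℂ} (hf : Integrable f) (hf2 : MemLp f 2) :
    ∫⁻ ξ, ‖𝓕 f ξ‖ₑ ^ 2 = ∫⁻ x, ‖f x‖ₑ ^ 2 := by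
  rw [← enorm_toLp_two_sq hf2, ← enorm_fourier_Lp, enorm_Lp_two_sq]
  exact (lintegral_congr_ae ((fourier_toLp_ae_eq hf hf2).fun_comp fun z => ‖z‖ₑ ^ 2)).symm

lemma conj_fourier (w : V → ℂ) (x : V) : conj (𝓕 w x) = 𝓕⁻ (fun ξ => conj (w ξ)) x := by
  rw [Real.fourier_eq', Real.fourierInv_eq', ← integral_conj]
  congr 1 with ξ
  simp only [smul_eq_mul, map_mul, ← Complex.exp_conj, Complex.conj_ofReal, Complex.conj_I]
  congr 2
  push_cast
  ring

lemma conj_fourierInv (w : V → ℂ) (x : V) : conj (𝓕⁻ w x) = 𝓕 (fun ξ => conj (w ξ)) x := by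
  rw [Real.fourierInv_eq_fourier_neg, conj_fourier, Real.fourierInv_eq_fourier_neg, neg_neg]

end Plancherel

section DifferenceSymbol

/-- The Fourier symbol of the difference operator `f ↦ f (· + h) - f`. -/
noncomputable def diffSymbol (h ξ : ℝ) : ℂ := Real.fourierChar (h * ξ) - 1

lemma continuous_diffSymbol : Continuous fun p : ℝ × ℝ => diffSymbol p.1 p.2 := by
  have := Real.continuous_fourierChar
  unfold diffSymbol
  fun_prop

lemma measurable_diffSymbol_left (ξ : ℝ) : Measurable fun h => diffSymbol h ξ :=
  continuous_diffSymbol.measurable.comp measurable_prodMk_right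

lemma measurable_diffSymbol_right (h : ℝ) : Measurable fun ξ => diffSymbol h ξ :=
  continuous_diffSymbol.measurable.comp measurable_prodMk_left

@[simp]
lemma diffSymbol_zero_right (h : ℝ) : diffSymbol h 0 = 0 := by
  simp [diffSymbol]

lemma norm_diffSymbol_le_two (h ξ : ℝ) : ‖diffSymbol h ξ‖ ≤ 2 :=
  (norm_sub_le _ _).trans (by rw [Circle.norm_coe, norm_one, one_add_one_eq_two])

lemma norm_diffSymbol_le (h ξ : ℝ) : ‖diffSymbol h ξ‖ ≤ 2 * Real.pi * |h| * |ξ| := by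
  rw [diffSymbol, Real.fourierChar_apply, mul_comm _ Complex.I]
  refine (Real.norm_exp_I_mul_ofReal_sub_one_le).trans_eq ?_
  rw [Real.norm_eq_abs, abs_mul (2 * Real.pi), abs_mul h, abs_of_pos Real.two_pi_pos, mul_assoc,
    mul_assoc, mul_assoc]

lemma fourier_comp_add_sub {f : ℝ → ℂ} (hf : Integrable f) (h ξ : ℝ) :
    𝓕 (fun x => f (x + h) - f x) ξ = diffSymbol h ξ * 𝓕 f ξ := by
  have hshift : 𝓕 (fun x => f (x + h)) ξ = Real.fourierChar (h * ξ) * 𝓕 f ξ := by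
    have := congrFun (VectorFourier.fourierIntegral_comp_add_right Real.fourierChar volume
      (innerₗ ℝ) f h) ξ
    rwa [innerₗ_apply_apply, real_inner_eq_re_inner, RCLike.inner_apply, conj_trivial,
      RCLike.re_to_real, mul_comm, Circle.smul_def, smul_eq_mul] at this
  have hsub : 𝓕 (fun x => f (x + h) - f x) ξ = 𝓕 (fun x => f (x + h)) ξ - 𝓕 f ξ := by
    simp only [Real.fourier_eq, smul_sub]
    exact integral_sub ((Real.fourierIntegral_convergent_iff ξ).2 (hf.comp_add_right h))
      ((Real.fourierIntegral_convergent_iff ξ).2 hf)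
  rw [hsub, hshift, diffSymbol, sub_one_mul]

lemma fourier_diffSymbol_mul {q : ℝ → ℂ} (hq : Integrable q) (h x : ℝ) :
    𝓕 (fun ξ => diffSymbol h ξ * q ξ) x = 𝓕 q (x - h) - 𝓕 q x := by
  simp only [Real.fourier_real_eq]
  rw [← integral_sub]
  · congr 1 with ξ
    simp only [diffSymbol, Circle.smul_def, smul_eq_mul]
    rw [show -(ξ * (x - h)) = h * ξ + -(ξ * x) by ring, AddChar.map_add_eq_mul, Circle.coe_mul]
    ring
  · simpa [mul_comm] using (Real.fourierIntegral_convergent_iff (x - h)).2 hq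
  · simpa [mul_comm] using (Real.fourierIntegral_convergent_iff x).2 hq

end DifferenceSymbol

section Gagliardo

variable {E : Type*} [NormedAddCommGroup E]

lemma lintegral_eq_mul_lintegral_comp_mul_left (F : ℝ → ℝ≥0∞) {c : ℝ} (hc : c ≠ 0) :
    ∫⁻ x, F x = ‖c‖ₑ * ∫⁻ x, F (c * x) := by
  have h := (Homeomorph.mulLeft₀ c hc).measurableEmbedding.lintegral_map (μ := volume) F
  simp only [Homeomorph.coe_mulLeft₀] at h
  conv_lhs => rw [← Real.smul_map_volume_mul_left hc]
  rw [lintegral_smul_measure, h, smul_eq_mul, Real.enorm_eq_ofReal_abs]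

/-- The constant `∫ |exp (2πit) - 1|² / t² dt`, by which the Gagliardo seminorm differs from the
integral of `|ξ| |𝓕 f ξ|²`. -/
noncomputable def kernelConst : ℝ≥0∞ := ∫⁻ t : ℝ, ‖diffSymbol t 1‖ₑ ^ 2 / ‖t‖ₑ ^ 2

lemma kernelConst_ne_top : kernelConst ≠ ⊤ := by
  refine ne_top_of_le_ne_top (integrable_inv_one_add_sq.const_mul
    (4 * Real.pi ^ 2 + 4)).lintegral_lt_top.ne (lintegral_mono_ae ?_)
  filter_upwards [volume.ae_ne 0] with t ht
  have ht2 : 0 < |t| ^ 2 := by positivity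
  rw [← ofReal_norm, ← ofReal_norm, ← ENNReal.ofReal_pow (norm_nonneg _),
    ← ENNReal.ofReal_pow (norm_nonneg _), Real.norm_eq_abs, ← ENNReal.ofReal_div_of_pos ht2]
  refine ENNReal.ofReal_le_ofReal ?_
  have h_far : ‖diffSymbol t 1‖ ^ 2 ≤ 2 ^ 2 := by
    gcongr
    exact norm_diffSymbol_le_two t 1
  have h_near : ‖diffSymbol t 1‖ ^ 2 ≤ (2 * Real.pi * |t| * |1|) ^ 2 := by
    gcongr
    exact norm_diffSymbol_le t 1
  rw [abs_one, mul_one, mul_pow] at h_near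
  rw [← div_eq_mul_inv, ← sq_abs t, div_le_div_iff₀ ht2 (by positivity)]
  nlinarith

lemma kernelConst_ne_zero : kernelConst ≠ 0 := by
  intro h
  have hmeas : Measurable fun t : ℝ => ‖diffSymbol t 1‖ₑ ^ 2 / ‖t‖ₑ ^ 2 :=
    ((measurable_diffSymbol_left 1).enorm.pow_const 2).div (measurable_enorm.pow_const 2)
  have hzero : (fun t => diffSymbol t 1) =ᵐ[volume] fun _ => 0 := by
    filter_upwards [(lintegral_eq_zero_iff hmeas).1 h] with t ht
    simpa using ht
  have hcont : Continuous fun t => diffSymbol t 1 :=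
    continuous_diffSymbol.comp (by fun_prop : Continuous fun t : ℝ => (t, (1 : ℝ)))
  have hhalf := congrFun ((hcont.ae_eq_iff_eq volume continuous_const).1 hzero) (1 / 2)
  have hpi : ((2 * Real.pi * (1 / 2 * 1) : ℝ) : ℂ) * Complex.I = Real.pi * Complex.I := by
    push_cast
    ring
  rw [diffSymbol, Real.fourierChar_apply, hpi, Complex.exp_pi_mul_I] at hhalf
  norm_num at hhalf

lemma lintegral_diffSymbol_div (ξ : ℝ) :
    ∫⁻ h : ℝ, ‖diffSymbol h ξ‖ₑ ^ 2 / ‖h‖ₑ ^ 2 = kernelConst * ‖ξ‖ₑ := by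
  rcases eq_or_ne ξ 0 with rfl | hξ
  · simp
  have hscale (h : ℝ) : ‖diffSymbol h ξ‖ₑ ^ 2 / ‖h‖ₑ ^ 2
      = ‖ξ‖ₑ ^ 2 * (‖diffSymbol (ξ * h) 1‖ₑ ^ 2 / ‖ξ * h‖ₑ ^ 2) := by
    rw [diffSymbol, diffSymbol, mul_one, mul_comm h ξ, enorm_mul, mul_pow, ← mul_div_assoc,
      ENNReal.mul_div_mul_left _ _ (by simpa using hξ) (by finiteness)]
  simp only [hscale]
  rw [lintegral_const_mul' _ _ (by finiteness), kernelConst,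
    lintegral_eq_mul_lintegral_comp_mul_left (fun t => ‖diffSymbol t 1‖ₑ ^ 2 / ‖t‖ₑ ^ 2) hξ]
  ring

/-- The square of the Gagliardo seminorm of order `1/2` on the line, written as an integral over the
increment `h` of the squared `L²` norm of `f (· + h) - f`. -/
noncomputable def gagliardo (f : ℝ → E) : ℝ≥0∞ :=
  ∫⁻ h : ℝ, (∫⁻ x, ‖f (x + h) - f x‖ₑ ^ 2) / ‖h‖ₑ ^ 2

lemma gagliardo_ofReal (f : ℝ → ℝ) : gagliardo (fun x => (f x : ℂ)) = gagliardo f := by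
  simp only [gagliardo, ← Complex.ofReal_sub, enorm_ofReal]

lemma gagliardo_const_sub (c : E) (f : ℝ → E) : gagliardo (fun x => c - f x) = gagliardo f := by
  simp only [gagliardo, sub_sub_sub_cancel_left, enorm_sub_rev]

lemma gagliardo_comp_mul_sub (f : ℝ → E) {c : ℝ} (hc : c ≠ 0) (a : ℝ) :
    gagliardo (fun x => f (c * (x - a))) = gagliardo f := by
  have htranslate (h : ℝ) : ∫⁻ x, ‖f (c * (x + h - a)) - f (c * (x - a))‖ₑ ^ 2
      = ∫⁻ x, ‖f (c * x + c * h) - f (c * x)‖ₑ ^ 2 := by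
    rw [← lintegral_sub_right_eq_self (fun x => ‖f (c * x + c * h) - f (c * x)‖ₑ ^ 2) a]
    simp only [← mul_add, sub_add_eq_add_sub]
  have hscale (t : ℝ) : ∫⁻ y, ‖f (y + t) - f y‖ₑ ^ 2
      = ‖c‖ₑ * ∫⁻ x, ‖f (c * x + t) - f (c * x)‖ₑ ^ 2 :=
    lintegral_eq_mul_lintegral_comp_mul_left (fun y => ‖f (y + t) - f y‖ₑ ^ 2) hc
  simp only [gagliardo, htranslate, hscale]
  rw [lintegral_eq_mul_lintegral_comp_mul_left
    (fun h => ‖c‖ₑ * (∫⁻ x, ‖f (c * x + h) - f (c * x)‖ₑ ^ 2) / ‖h‖ₑ ^ 2) hc,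
    ← lintegral_const_mul' _ _ (by finiteness)]
  refine lintegral_congr fun h => ?_
  rw [enorm_mul, mul_pow, ← mul_div_assoc, ← mul_assoc, ← sq,
    ENNReal.mul_div_mul_left _ _ (by simpa using hc) (by finiteness)]

lemma gagliardo_eq_of_lintegral_sub_sq {f : ℝ → E} {F : ℝ → ℝ≥0∞} (hF : AEMeasurable F)
    (hf : ∀ h, ∫⁻ x, ‖f (x + h) - f x‖ₑ ^ 2 = ∫⁻ ξ, ‖diffSymbol h ξ‖ₑ ^ 2 * F ξ) :
    gagliardo f = kernelConst * ∫⁻ ξ, ‖ξ‖ₑ * F ξ := by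
  have hright (h : ℝ) : AEMeasurable fun ξ => ‖diffSymbol h ξ‖ₑ ^ 2 * F ξ :=
    ((measurable_diffSymbol_right h).enorm.pow_const 2).aemeasurable.mul hF
  have hleft (ξ : ℝ) : Measurable fun h : ℝ => ‖diffSymbol h ξ‖ₑ ^ 2 / ‖h‖ₑ ^ 2 :=
    ((measurable_diffSymbol_left ξ).enorm.pow_const 2).div (measurable_enorm.pow_const 2)
  have hprod : AEMeasurable (fun p : ℝ × ℝ => ‖diffSymbol p.1 p.2‖ₑ ^ 2 * F p.2 * (‖p.1‖ₑ ^ 2)⁻¹)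
      (volume.prod volume) :=
    ((continuous_diffSymbol.measurable.enorm.pow_const 2).aemeasurable.mul hF.comp_snd).mul
      ((measurable_enorm.comp measurable_fst).pow_const 2).inv.aemeasurable
  calc gagliardo f
      = ∫⁻ h : ℝ, ∫⁻ ξ, ‖diffSymbol h ξ‖ₑ ^ 2 * F ξ * (‖h‖ₑ ^ 2)⁻¹ := by
        simp only [gagliardo, hf, div_eq_mul_inv, lintegral_mul_const'' _ (hright _)]
    _ = ∫⁻ ξ, ∫⁻ h : ℝ, ‖diffSymbol h ξ‖ₑ ^ 2 * F ξ * (‖h‖ₑ ^ 2)⁻¹ :=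
        lintegral_lintegral_swap hprod
    _ = ∫⁻ ξ, kernelConst * (‖ξ‖ₑ * F ξ) := by
        refine lintegral_congr fun ξ => ?_
        rw [← mul_assoc, ← lintegral_diffSymbol_div, ← lintegral_mul_const _ (hleft ξ)]
        simp only [div_eq_mul_inv, mul_right_comm]
    _ = kernelConst * ∫⁻ ξ, ‖ξ‖ₑ * F ξ :=
        lintegral_const_mul'' _ (measurable_enorm.aemeasurable.mul hF)

lemma gagliardo_eq_fourier {f : ℝ → ℂ} (hf : Integrable f) (hf2 : MemLp f 2) :
    gagliardo f = kernelConst * ∫⁻ ξ, ‖ξ‖ₑ * ‖𝓕 f ξ‖ₑ ^ 2 := by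
  refine gagliardo_eq_of_lintegral_sub_sq
    ((continuous_fourier hf).measurable.enorm.pow_const 2).aemeasurable fun h => ?_
  have hint : Integrable fun x => f (x + h) - f x := (hf.comp_add_right h).sub hf
  have hL2 : MemLp (fun x => f (x + h) - f x) 2 :=
    (hf2.comp_measurePreserving (measurePreserving_add_right volume h)).sub hf2
  simp only [← lintegral_enorm_fourier_sq hint hL2, fourier_comp_add_sub hf, enorm_mul, mul_pow]

lemma gagliardo_schwartz_ne_top (ψ : 𝓢(ℝ, ℂ)) : gagliardo ψ ≠ ⊤ := by
  rw [gagliardo_eq_fourier ψ.integrable (ψ.memLp 2)]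
  refine ENNReal.mul_ne_top kernelConst_ne_top ?_
  obtain ⟨C, -, hC⟩ := (𝓕 ψ).decay 0 0
  have hint : Integrable fun ξ => (‖ξ‖ ^ 1 * ‖(𝓕 ψ) ξ‖) * ‖(𝓕 ψ) ξ‖ :=
    ((𝓕 ψ).integrable_pow_mul volume 1).mul_bdd (c := C) (𝓕 ψ).continuous.norm.aestronglyMeasurable
      (ae_of_all _ fun ξ => by simpa using hC ξ)
  convert! hint.2.ne using 2
  ext ξ
  rw [enorm_mul, enorm_mul, pow_one, enorm_norm, enorm_norm, sq, mul_assoc, SchwartzMap.fourier_coe]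

lemma gagliardo_ne_top_of_contDiff {φ : ℝ → ℝ} (hφ : ContDiff ℝ ∞ φ) (hc : HasCompactSupport φ) :
    gagliardo φ ≠ ⊤ := by
  have hc' : HasCompactSupport fun x => (φ x : ℂ) := hc.comp_left Complex.ofReal_zero
  rw [← gagliardo_ofReal]
  exact gagliardo_schwartz_ne_top (hc'.toSchwartzMap (Complex.ofRealCLM.contDiff.comp hφ))

lemma enorm_add_sq_le (a b : E) : ‖a + b‖ₑ ^ 2 ≤ 2 * (‖a‖ₑ ^ 2 + ‖b‖ₑ ^ 2) := by
  have h := ENNReal.rpow_add_le_mul_rpow_add_rpow ‖a‖ₑ ‖b‖ₑ one_le_two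
  norm_num at h
  exact (pow_le_pow_left' (enorm_add_le a b) 2).trans h

lemma gagliardo_mul_le {R : Type*} [NormedDivisionRing R] {f η : ℝ → R} {B M : ℝ}
    (hB : ∀ᵐ x, ‖f x‖ ≤ B) (hη : Continuous η) (hM : ∀ x, ‖η x‖ ≤ M) :
    gagliardo (fun x => f x * η x) ≤ 2 * (‖M‖ₑ ^ 2 * gagliardo f + ‖B‖ₑ ^ 2 * gagliardo η) := by
  have hcont : Continuous fun p : ℝ × ℝ => ‖η (p.2 + p.1) - η p.2‖ₑ ^ 2 := by fun_prop
  have hpointwise (h : ℝ) : ∀ᵐ x, ‖f (x + h) * η (x + h) - f x * η x‖ₑ ^ 2 ≤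
      2 * (‖M‖ₑ ^ 2 * ‖f (x + h) - f x‖ₑ ^ 2 + ‖B‖ₑ ^ 2 * ‖η (x + h) - η x‖ₑ ^ 2) := by
    filter_upwards [hB] with x hx
    have hleibniz : f (x + h) * η (x + h) - f x * η x
        = (f (x + h) - f x) * η (x + h) + f x * (η (x + h) - η x) := by noncomm_ring
    have h₁ : ‖(f (x + h) - f x) * η (x + h)‖ₑ ≤ ‖M‖ₑ * ‖f (x + h) - f x‖ₑ := by
      rw [mul_comm]
      exact (enorm_mul _ _).trans_le
        (mul_le_mul_right (enorm_le_iff_norm_le.2 ((hM _).trans (le_abs_self M))) _)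
    have h₂ : ‖f x * (η (x + h) - η x)‖ₑ ≤ ‖B‖ₑ * ‖η (x + h) - η x‖ₑ :=
      (enorm_mul _ _).trans_le
        (mul_le_mul_left (enorm_le_iff_norm_le.2 (hx.trans (le_abs_self B))) _)
    rw [hleibniz, ← mul_pow, ← mul_pow]
    refine (enorm_add_sq_le _ _).trans ?_
    gcongr
  have hslice (h : ℝ) : ∫⁻ x, ‖f (x + h) * η (x + h) - f x * η x‖ₑ ^ 2 ≤
      2 * (‖M‖ₑ ^ 2 * ∫⁻ x, ‖f (x + h) - f x‖ₑ ^ 2) +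
        2 * (‖B‖ₑ ^ 2 * ∫⁻ x, ‖η (x + h) - η x‖ₑ ^ 2) := by
    refine (lintegral_mono_ae (hpointwise h)).trans_eq ?_
    have hmeas : Measurable fun x => ‖η (x + h) - η x‖ₑ ^ 2 :=
      hcont.measurable.comp measurable_prodMk_left
    rw [lintegral_const_mul' _ _ (by finiteness), lintegral_add_right _ (hmeas.const_mul _),
      lintegral_const_mul' _ _ (by finiteness), lintegral_const_mul' _ _ (by finiteness), mul_add]
  have hmeas : Measurable fun h : ℝ => (∫⁻ x, ‖η (x + h) - η x‖ₑ ^ 2) / ‖h‖ₑ ^ 2 :=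
    hcont.measurable.lintegral_prod_right.div (measurable_enorm.pow_const 2)
  calc gagliardo (fun x => f x * η x)
      ≤ ∫⁻ h : ℝ, (2 * ‖M‖ₑ ^ 2 * ((∫⁻ x, ‖f (x + h) - f x‖ₑ ^ 2) / ‖h‖ₑ ^ 2) +
          2 * ‖B‖ₑ ^ 2 * ((∫⁻ x, ‖η (x + h) - η x‖ₑ ^ 2) / ‖h‖ₑ ^ 2)) := by
        refine lintegral_mono fun h => (ENNReal.div_le_div_right (hslice h) _).trans_eq ?_
        simp only [ENNReal.add_div, ← mul_assoc, mul_div_assoc]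
    _ = 2 * (‖M‖ₑ ^ 2 * gagliardo f + ‖B‖ₑ ^ 2 * gagliardo η) := by
        rw [lintegral_add_right _ (hmeas.const_mul _), lintegral_const_mul' _ _ (by finiteness),
          lintegral_const_mul' _ _ (by finiteness), gagliardo, gagliardo]
        ring

end Gagliardo

section QuarterLaplacian

/-- The symbol `(2π|ξ|)^{1/2}` of `(-Δ)^{1/4}`. -/
noncomputable def quarterSymbol (ξ : ℝ) : ℝ := (2 * Real.pi * |ξ|) ^ (1 / 2 : ℝ)

lemma quarterSymbol_nonneg (ξ : ℝ) : 0 ≤ quarterSymbol ξ := by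
  unfold quarterSymbol
  positivity

lemma quarterSymbol_pos {ξ : ℝ} (hξ : ξ ≠ 0) : 0 < quarterSymbol ξ := by
  unfold quarterSymbol
  positivity

lemma continuous_quarterSymbol : Continuous quarterSymbol :=
  Continuous.rpow_const (by fun_prop) fun _ => Or.inr (by norm_num)

lemma quarterSymbol_sq (ξ : ℝ) : quarterSymbol ξ ^ 2 = 2 * Real.pi * |ξ| := by
  rw [quarterSymbol, ← Real.rpow_natCast, ← Real.rpow_mul (by positivity)]
  norm_num

lemma enorm_quarterSymbol_sq (ξ : ℝ) :
    ‖quarterSymbol ξ‖ₑ ^ 2 = ENNReal.ofReal (2 * Real.pi) * ‖ξ‖ₑ := by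
  rw [← enorm_pow, quarterSymbol_sq, enorm_mul, Real.enorm_abs,
    Real.enorm_of_nonneg Real.two_pi_pos.le]

lemma quarterSymbol_le (ξ : ℝ) : quarterSymbol ξ ≤ 1 + 2 * Real.pi * |ξ| := by
  have := quarterSymbol_sq ξ
  nlinarith [sq_nonneg (quarterSymbol ξ - 1)]

lemma integrable_quarterSymbol_mul (q : 𝓢(ℝ, ℂ)) :
    Integrable fun ξ => (quarterSymbol ξ : ℂ) * q ξ := by
  refine (q.integrable.norm.add ((q.integrable_pow_mul volume 1).const_mul (2 * Real.pi))).mono'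
    ((Complex.continuous_ofReal.comp continuous_quarterSymbol).mul
      q.continuous).aestronglyMeasurable (ae_of_all _ fun ξ => ?_)
  rw [norm_mul, Complex.norm_real, Real.norm_of_nonneg (quarterSymbol_nonneg ξ)]
  refine (mul_le_mul_of_nonneg_right (quarterSymbol_le ξ) (norm_nonneg (q ξ))).trans_eq ?_
  simp only [Pi.add_apply, pow_one, Real.norm_eq_abs]
  ring

lemma quarterLaplacianSchwartz_eq (ψ : 𝓢(ℝ, ℂ)) :
    quarterLaplacianSchwartz ψ = 𝓕 (fun ξ => (quarterSymbol ξ : ℂ) * (𝓕⁻ ψ : 𝓢(ℝ, ℂ)) ξ) := by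
  rw [quarterLaplacianSchwartz, Real.fourierInv_eq_fourier_comp_neg]
  congr 1 with ξ
  rw [SchwartzMap.fourierInv_coe, Real.fourierInv_eq_fourier_neg, quarterSymbol, abs_neg]

lemma continuous_quarterLaplacianSchwartz (ψ : 𝓢(ℝ, ℂ)) :
    Continuous (quarterLaplacianSchwartz ψ) := by
  rw [quarterLaplacianSchwartz_eq]
  exact continuous_fourier (integrable_quarterSymbol_mul _)

lemma exists_norm_quarterLaplacianSchwartz_le (ψ : 𝓢(ℝ, ℂ)) :
    ∃ C, ∀ x, ‖quarterLaplacianSchwartz ψ x‖ ≤ C := by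
  rw [quarterLaplacianSchwartz_eq]
  exact ⟨_, fun x => VectorFourier.norm_fourierIntegral_le_integral_norm _ _ _ _ x⟩

lemma conj_quarterLaplacianSchwartz {ψ : 𝓢(ℝ, ℂ)} (hψ : ∀ x, conj (ψ x) = ψ x) (x : ℝ) :
    conj (quarterLaplacianSchwartz ψ x) = quarterLaplacianSchwartz ψ x := by
  rw [quarterLaplacianSchwartz, conj_fourierInv, Real.fourierInv_eq_fourier_comp_neg]
  refine congrFun (congrArg 𝓕 (funext fun ξ => ?_)) x
  rw [map_mul, Complex.conj_ofReal, conj_fourier, abs_neg, Real.fourierInv_eq_fourier_neg,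
    funext hψ]

lemma memLp_quarterSymbol_mul_fourier {f : ℝ → ℂ} (hf : Integrable f) (hf2 : MemLp f 2)
    (hfin : gagliardo f ≠ ⊤) : MemLp (fun ξ => (quarterSymbol ξ : ℂ) * 𝓕 f ξ) 2 := by
  have hmeas : AEStronglyMeasurable (fun ξ => (quarterSymbol ξ : ℂ) * 𝓕 f ξ) volume :=
    ((Complex.continuous_ofReal.comp continuous_quarterSymbol).mul
      (continuous_fourier hf)).aestronglyMeasurable
  rw [memLp_two_iff_lintegral_ne_top hmeas]
  rw [gagliardo_eq_fourier hf hf2] at hfin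
  simp only [enorm_mul, mul_pow, enorm_ofReal, enorm_quarterSymbol_sq, mul_assoc]
  rw [lintegral_const_mul' _ _ ENNReal.ofReal_ne_top]
  exact ENNReal.mul_ne_top ENNReal.ofReal_ne_top
    (ENNReal.lt_top_of_mul_ne_top_right hfin kernelConst_ne_zero).ne

lemma exists_Lp_integral_mul_quarterLaplacianSchwartz {f : ℝ → ℂ} (hf : Integrable f)
    (hf2 : MemLp f 2) (hfin : gagliardo f ≠ ⊤) :
    ∃ G : Lp ℂ 2 (volume : Measure ℝ), ∀ ψ : 𝓢(ℝ, ℂ),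
      ∫ x, f x * quarterLaplacianSchwartz ψ x = ∫ x, G x * ψ x := by
  have hN := memLp_quarterSymbol_mul_fourier hf hf2 hfin
  refine ⟨𝓕⁻ (hN.toLp _), fun ψ => ?_⟩
  rw [quarterLaplacianSchwartz_eq, ← integral_fourier_mul hf (integrable_quarterSymbol_mul _),
    ← integral_fourier_Lp_mul_fourierInv, FourierTransform.fourier_fourierInv_eq]
  refine integral_congr_ae ?_
  filter_upwards [hN.coeFn_toLp] with ξ hξ
  rw [hξ]
  ring

lemma conj_ae_eq_of_integral_mul_quarterLaplacianSchwartz {f : ℝ → ℝ} {G : ℝ → ℂ}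
    (hG : LocallyIntegrable G)
    (h : ∀ ψ : 𝓢(ℝ, ℂ), ∫ x, (f x : ℂ) * quarterLaplacianSchwartz ψ x = ∫ x, G x * ψ x) :
    (fun x => conj (G x)) =ᵐ[volume] G := by
  have hG' : LocallyIntegrable fun x => conj (G x) := fun x =>
    (hG x).imp fun s hs => ⟨hs.1, Complex.conjCLE.toContinuousLinearMap.integrable_comp hs.2⟩
  refine ae_eq_of_integral_mul_schwartz hG' hG fun q hq => ?_
  calc ∫ x, conj (G x) * q x
      = conj (∫ x, G x * q x) := by simp only [← integral_conj, map_mul, hq]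
    _ = conj (∫ x, (f x : ℂ) * quarterLaplacianSchwartz q x) := by rw [h]
    _ = ∫ x, (f x : ℂ) * quarterLaplacianSchwartz q x := by
        simp only [← integral_conj, map_mul, Complex.conj_ofReal, conj_quarterLaplacianSchwartz hq]
    _ = ∫ x, G x * q x := h q

lemma memHomHalf_of_gagliardo_ne_top {f : ℝ → ℝ} (hf : Integrable f) (hf2 : MemLp f 2)
    (hfin : gagliardo f ≠ ⊤) : MemHomHalf f := by
  obtain ⟨G, hG⟩ := exists_Lp_integral_mul_quarterLaplacianSchwartz hf.ofReal hf2.ofReal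
    ((gagliardo_ofReal f).trans_ne hfin)
  have hre : ∀ᵐ x, (((G x).re : ℝ) : ℂ) = G x := by
    filter_upwards [conj_ae_eq_of_integral_mul_quarterLaplacianSchwartz
      ((Lp.memLp G).locallyIntegrable one_le_two) hG] with x hx
    exact Complex.conj_eq_iff_re.1 hx
  refine ⟨fun x => (G x).re, hf.locallyIntegrable, (Lp.memLp G).re, fun ψ => ?_, fun ψ => ?_⟩
  · obtain ⟨C, hC⟩ := exists_norm_quarterLaplacianSchwartz_le ψ
    exact hf.ofReal.mul_bdd (continuous_quarterLaplacianSchwartz ψ).aestronglyMeasurable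
      (ae_of_all _ hC)
  · exact (hG ψ).trans (integral_congr_ae (hre.mono fun x hx => by simp only [hx]))

lemma MemHomHalf.isQuarterLaplacian {f : ℝ → ℝ} (hf : MemHomHalf f) :
    IsQuarterLaplacian f (quarterLaplacian f) := by
  rw [quarterLaplacian, dif_pos hf]
  exact hf.choose_spec

end QuarterLaplacian

section Sobolev

lemma lintegral_mul_sq_le {α : Type*} {mα : MeasurableSpace α} {μ : Measure α} {a b : α → ℝ≥0∞}
    (ha : AEMeasurable a μ) (hb : AEMeasurable b μ) :
    (∫⁻ x, a x * b x ∂μ) ^ 2 ≤ (∫⁻ x, a x ^ 2 ∂μ) * ∫⁻ x, b x ^ 2 ∂μ := by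
  have hroot (y : ℝ≥0∞) : (y ^ (1 / 2 : ℝ)) ^ 2 = y := by
    rw [← ENNReal.rpow_natCast, ← ENNReal.rpow_mul]
    norm_num
  have h := ENNReal.lintegral_mul_le_Lp_mul_Lq μ Real.HolderConjugate.two_two ha hb
  simp only [ENNReal.rpow_two, Pi.mul_apply] at h
  exact (pow_le_pow_left' h 2).trans_eq (by rw [mul_pow, hroot, hroot])

lemma sq_lintegral_le_pi_mul {F : ℝ → ℝ≥0∞} (hF : AEMeasurable F) :
    (∫⁻ x, F x) ^ 2 ≤
      ENNReal.ofReal Real.pi * ∫⁻ x : ℝ, ENNReal.ofReal (1 + x ^ 2) * F x ^ 2 := by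
  have hsq (x : ℝ) : ENNReal.ofReal √(1 + x ^ 2) ^ 2 = ENNReal.ofReal (1 + x ^ 2) := by
    rw [← ENNReal.ofReal_pow (by positivity), Real.sq_sqrt (by positivity)]
  have hinv_sq (x : ℝ) : ENNReal.ofReal (√(1 + x ^ 2))⁻¹ ^ 2 = ENNReal.ofReal (1 + x ^ 2)⁻¹ := by
    rw [← ENNReal.ofReal_pow (by positivity), inv_pow, Real.sq_sqrt (by positivity)]
  have hcancel (x : ℝ) :
      ENNReal.ofReal (√(1 + x ^ 2))⁻¹ * (ENNReal.ofReal √(1 + x ^ 2) * F x) = F x := by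
    have hpos : 0 < √(1 + x ^ 2) := by positivity
    rw [← mul_assoc, ← ENNReal.ofReal_mul (by positivity), inv_mul_cancel₀ hpos.ne',
      ENNReal.ofReal_one, one_mul]
  have h := lintegral_mul_sq_le (α := ℝ) (μ := volume)
    (a := fun x : ℝ => ENNReal.ofReal (√(1 + x ^ 2))⁻¹)
    (b := fun x : ℝ => ENNReal.ofReal √(1 + x ^ 2) * F x) (by fun_prop) (by fun_prop)
  simpa only [hcancel, mul_pow, hsq, hinv_sq, ← integral_univ_inv_one_add_sq,
    ofReal_integral_eq_lintegral_ofReal integrable_inv_one_add_sq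
      (ae_of_all _ fun x : ℝ => inv_nonneg.2 (by positivity : (0 : ℝ) ≤ 1 + x ^ 2))] using h

lemma enorm_mul_fourier_le_enorm_fourier_deriv {w : ℝ → ℂ} (hw : Integrable w)
    (hd : Differentiable ℝ w) (hw' : Integrable (deriv w)) (ξ : ℝ) :
    ENNReal.ofReal (ξ ^ 2) * ‖𝓕 w ξ‖ₑ ^ 2 ≤ ‖𝓕 (deriv w) ξ‖ₑ ^ 2 := by
  have hsymbol : ‖(2 * Real.pi * Complex.I * ξ : ℂ)‖ = 2 * Real.pi * |ξ| := by
    simp [abs_of_pos Real.pi_pos]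
  rw [Real.fourier_deriv hw hd hw', enorm_smul, mul_pow]
  gcongr
  rw [← ofReal_norm, ← ENNReal.ofReal_pow (norm_nonneg _), hsymbol, mul_pow, sq_abs]
  refine ENNReal.ofReal_le_ofReal (le_mul_of_one_le_left (sq_nonneg ξ) ?_)
  nlinarith [Real.pi_gt_three]

lemma sq_lintegral_enorm_fourier_le {w : ℝ → ℂ} (hw : Integrable w) (hw2 : MemLp w 2)
    (hd : Differentiable ℝ w) (hw' : Integrable (deriv w)) (hw2' : MemLp (deriv w) 2) :
    (∫⁻ ξ, ‖𝓕 w ξ‖ₑ) ^ 2 ≤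
      ENNReal.ofReal Real.pi * ((∫⁻ x, ‖w x‖ₑ ^ 2) + ∫⁻ x, ‖deriv w x‖ₑ ^ 2) := by
  have hmeas : Measurable fun ξ => ‖𝓕 w ξ‖ₑ := (continuous_fourier hw).measurable.enorm
  refine (sq_lintegral_le_pi_mul hmeas.aemeasurable).trans ?_
  rw [← lintegral_enorm_fourier_sq hw hw2, ← lintegral_enorm_fourier_sq hw' hw2',
    ← lintegral_add_left (hmeas.pow_const 2)]
  gcongr with ξ
  rw [ENNReal.ofReal_add zero_le_one (sq_nonneg ξ), ENNReal.ofReal_one, add_mul, one_mul]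
  gcongr
  exact enorm_mul_fourier_le_enorm_fourier_deriv hw hd hw' ξ

lemma tendsto_lintegral_enorm_fourier_zero {w : ℕ → 𝓢(ℝ, ℂ)}
    (hw : Tendsto (fun n => ∫⁻ x, ‖w n x‖ₑ ^ 2) atTop (𝓝 0))
    (hw' : Tendsto (fun n => ∫⁻ x, ‖deriv (w n) x‖ₑ ^ 2) atTop (𝓝 0)) :
    Tendsto (fun n => ∫⁻ ξ, ‖𝓕 (w n : ℝ → ℂ) ξ‖ₑ) atTop (𝓝 0) := by
  have hderiv (n : ℕ) : ⇑(SchwartzMap.derivCLM ℂ ℂ (w n)) = deriv (w n) :=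
    funext (SchwartzMap.derivCLM_apply ℂ (w n))
  have hint (n : ℕ) : Integrable (deriv (w n)) :=
    hderiv n ▸ (SchwartzMap.derivCLM ℂ ℂ (w n)).integrable
  have hmem (n : ℕ) : MemLp (deriv (w n)) 2 := hderiv n ▸ (SchwartzMap.derivCLM ℂ ℂ (w n)).memLp 2
  have hbound (n : ℕ) := sq_lintegral_enorm_fourier_le (w n).integrable ((w n).memLp 2)
    (w n).differentiable (hint n) (hmem n)
  have hsq : Tendsto (fun n => (∫⁻ ξ, ‖𝓕 (w n : ℝ → ℂ) ξ‖ₑ) ^ 2) atTop (𝓝 0) := by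
    refine tendsto_of_tendsto_of_tendsto_of_le_of_le tendsto_const_nhds ?_ (fun _ => zero_le) hbound
    simpa using ENNReal.Tendsto.const_mul (hw.add hw') (Or.inr ENNReal.ofReal_ne_top)
  have hroot (y : ℝ≥0∞) : (y ^ 2) ^ (2⁻¹ : ℝ) = y := by
    rw [← ENNReal.rpow_natCast, ← ENNReal.rpow_mul]
    norm_num
  simpa [hroot] using hsq.ennrpow_const 2⁻¹

end Sobolev

section Cutoff

/-- A fixed smooth function equal to `1` on `[-1, 1]` and to `0` outside `[-2, 2]`. -/
noncomputable def bump : ContDiffBump (0 : ℝ) := ⟨1, 2, one_pos, one_lt_two⟩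

lemma bump_eq_one {t : ℝ} (ht : |t| ≤ 1) : bump t = 1 :=
  bump.one_of_mem_closedBall (by simpa [bump] using ht)

lemma bump_eq_zero {t : ℝ} (ht : 2 ≤ |t|) : bump t = 0 :=
  bump.zero_of_le_dist (by simpa [bump] using ht)

lemma exists_abs_mul_deriv_bump_le : ∃ K, ∀ t, |t * deriv bump t| ≤ K :=
  (bump.hasCompactSupport.deriv.mul_left (f := fun t : ℝ => t)).exists_bound_of_continuous
    (continuous_id.mul (bump.contDiff.continuous_deriv le_rfl))

/-- A smooth function that is `0` near `0` and near infinity, and tends to `1` on `ℝ ∖ {0}` as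
`n → ∞`; the quotient `ξ² / (1 + ξ⁴)` is comparable to the minimum of `ξ²` and `ξ⁻²`. -/
noncomputable def annularCutoff (n : ℕ) (ξ : ℝ) : ℝ :=
  1 - bump (((n : ℝ) + 1) * (ξ ^ 2 / (1 + ξ ^ 4)))

lemma contDiff_annularCutoff (n : ℕ) : ContDiff ℝ ∞ (annularCutoff n) :=
  contDiff_const.sub (bump.contDiff.comp (contDiff_const.mul
    ((contDiff_id.pow 2).div (contDiff_const.add (contDiff_id.pow 4)) fun ξ => by positivity)))

lemma annularCutoff_eventuallyEq_zero (n : ℕ) : annularCutoff n =ᶠ[𝓝 0] 0 := by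
  have hcont : Continuous fun ξ : ℝ => ((n : ℝ) + 1) * (ξ ^ 2 / (1 + ξ ^ 4)) :=
    continuous_const.mul ((continuous_pow 2).div (by fun_prop) fun ξ => by positivity)
  have hsmall : ∀ᶠ ξ : ℝ in 𝓝 0, |((n : ℝ) + 1) * (ξ ^ 2 / (1 + ξ ^ 4))| < 1 :=
    (hcont.abs.tendsto 0).eventually_lt_const (by simp)
  filter_upwards [hsmall] with ξ hξ
  simp [annularCutoff, bump_eq_one hξ.le]

lemma hasCompactSupport_annularCutoff (n : ℕ) : HasCompactSupport (annularCutoff n) := by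
  refine HasCompactSupport.intro (isCompact_Icc (a := -((n : ℝ) + 1)) (b := n + 1)) fun ξ hξ => ?_
  have hlarge : (n : ℝ) + 1 < |ξ| := by
    by_contra! h
    exact hξ (abs_le.1 h)
  have hle : |((n : ℝ) + 1) * (ξ ^ 2 / (1 + ξ ^ 4))| ≤ 1 := by
    rw [abs_of_nonneg (by positivity), ← mul_div_assoc, div_le_one (by positivity)]
    have hξ2 : (n : ℝ) + 1 ≤ ξ ^ 2 := by
      rw [← sq_abs]
      nlinarith [n.cast_nonneg (α := ℝ)]
    nlinarith [sq_nonneg ξ]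
  rw [annularCutoff, bump_eq_one hle, sub_self]

lemma annularCutoff_mem_Icc (n : ℕ) (ξ : ℝ) : annularCutoff n ξ ∈ Set.Icc 0 1 :=
  ⟨sub_nonneg.2 bump.le_one, sub_le_self _ bump.nonneg⟩

lemma exists_abs_mul_deriv_annularCutoff_le :
    ∃ K, ∀ n ξ, |ξ * deriv (annularCutoff n) ξ| ≤ K := by
  obtain ⟨K, hK⟩ := exists_abs_mul_deriv_bump_le
  refine ⟨2 * K, fun n ξ => ?_⟩
  set t := ((n : ℝ) + 1) * (ξ ^ 2 / (1 + ξ ^ 4)) with ht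
  have hinner : HasDerivAt (fun ξ : ℝ => ((n : ℝ) + 1) * (ξ ^ 2 / (1 + ξ ^ 4)))
      (((n : ℝ) + 1) * ((2 * ξ * (1 + ξ ^ 4) - ξ ^ 2 * (4 * ξ ^ 3)) / (1 + ξ ^ 4) ^ 2)) ξ := by
    simpa using ((hasDerivAt_pow 2 ξ).div ((hasDerivAt_pow 4 ξ).const_add 1)
      (by positivity)).const_mul ((n : ℝ) + 1)
  have hderiv := ((bump.contDiff.differentiable one_ne_zero t).hasDerivAt.comp ξ hinner).const_sub 1
  have hscale : ξ * deriv (annularCutoff n) ξ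
      = -(2 * ((1 - ξ ^ 4) / (1 + ξ ^ 4)) * (t * deriv bump t)) := by
    refine (congrArg (ξ * ·) hderiv.deriv).trans ?_
    rw [ht]
    field_simp
    ring
  have hratio : |(1 - ξ ^ 4) / (1 + ξ ^ 4)| ≤ 1 := by
    have : 0 ≤ ξ ^ 4 := by positivity
    rw [abs_div, abs_of_pos (by positivity : 0 < 1 + ξ ^ 4), div_le_one (by positivity), abs_le]
    constructor <;> linarith
  rw [hscale, abs_neg, abs_mul, abs_mul, abs_two]
  calc 2 * |(1 - ξ ^ 4) / (1 + ξ ^ 4)| * |t * deriv bump t| ≤ 2 * 1 * K := by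
        gcongr
        exact hK t
    _ = 2 * K := by ring

lemma eventually_annularCutoff_eventuallyEq_one {ξ : ℝ} (hξ : ξ ≠ 0) :
    ∀ᶠ n in atTop, annularCutoff n =ᶠ[𝓝 ξ] 1 := by
  have hpos : 0 < ξ ^ 2 / (1 + ξ ^ 4) := by positivity
  have hlim : Tendsto (fun n : ℕ => ((n : ℝ) + 1) * (ξ ^ 2 / (1 + ξ ^ 4))) atTop atTop :=
    (tendsto_atTop_add_const_right _ _ tendsto_natCast_atTop_atTop).atTop_mul_const hpos
  filter_upwards [hlim.eventually_gt_atTop 2] with n hn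
  have hcont : Continuous fun ξ : ℝ => ((n : ℝ) + 1) * (ξ ^ 2 / (1 + ξ ^ 4)) :=
    continuous_const.mul ((continuous_pow 2).div (by fun_prop) fun ξ => by positivity)
  filter_upwards [(hcont.tendsto ξ).eventually_const_lt hn] with y hy
  simp [annularCutoff, bump_eq_zero (hy.le.trans (le_abs_self _))]

end Cutoff

section DifferenceQuotient

lemma norm_diffSymbol_div_le (h ξ : ℝ) : ‖diffSymbol h ξ / quarterSymbol ξ‖ ≤ √(2 * |h|) := by
  rcases eq_or_ne ξ 0 with rfl | hξ
  · simp
  have hpos := quarterSymbol_pos hξ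
  rw [norm_div, Complex.norm_real, Real.norm_of_nonneg hpos.le, div_le_iff₀ hpos]
  refine (pow_le_pow_iff_left₀ (norm_nonneg _) (by positivity) two_ne_zero).1 ?_
  calc ‖diffSymbol h ξ‖ ^ 2 ≤ 2 * (2 * Real.pi * |h| * |ξ|) := by
        rw [sq]
        exact mul_le_mul (norm_diffSymbol_le_two h ξ) (norm_diffSymbol_le h ξ) (norm_nonneg _)
          zero_le_two
    _ = (√(2 * |h|) * quarterSymbol ξ) ^ 2 := by
        rw [mul_pow, Real.sq_sqrt (by positivity), quarterSymbol_sq]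
        ring

lemma measurable_diffSymbol_div (h : ℝ) : Measurable fun ξ => diffSymbol h ξ / quarterSymbol ξ :=
  (measurable_diffSymbol_right h).div
    (Complex.measurable_ofReal.comp continuous_quarterSymbol.measurable)

/-- Multiplication of a Schwartz function by `diffSymbol h`. -/
noncomputable def diffSymbolMul (h : ℝ) (q : 𝓢(ℝ, ℂ)) : 𝓢(ℝ, ℂ) :=
  𝓕 (SchwartzMap.compSubConstCLM ℂ (-h) (𝓕⁻ q) - 𝓕⁻ q)

lemma diffSymbolMul_apply (h : ℝ) (q : 𝓢(ℝ, ℂ)) (ξ : ℝ) :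
    diffSymbolMul h q ξ = diffSymbol h ξ * q ξ := by
  have hsub : ((SchwartzMap.compSubConstCLM ℂ (-h) (𝓕⁻ q) - 𝓕⁻ q : 𝓢(ℝ, ℂ)) : ℝ → ℂ)
      = fun x => (𝓕⁻ q : 𝓢(ℝ, ℂ)) (x + h) - (𝓕⁻ q : 𝓢(ℝ, ℂ)) x := by
    ext x
    simp
  rw [diffSymbolMul, SchwartzMap.fourier_coe, hsub, fourier_comp_add_sub (𝓕⁻ q).integrable,
    ← SchwartzMap.fourier_coe, FourierTransform.fourier_fourierInv_eq]

lemma contDiff_div_quarterSymbol {θ : ℝ → ℝ} (hθ : ContDiff ℝ ∞ θ) (h0 : θ =ᶠ[𝓝 0] 0) :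
    ContDiff ℝ ∞ fun ξ => θ ξ / quarterSymbol ξ := by
  rw [contDiff_iff_contDiffAt]
  intro ξ
  rcases eq_or_ne ξ 0 with rfl | hξ
  · refine (contDiffAt_const (c := (0 : ℝ))).congr_of_eventuallyEq ?_
    filter_upwards [h0] with x hx
    simp [hx]
  · refine hθ.contDiffAt.div ?_ (quarterSymbol_pos hξ).ne'
    exact (contDiffAt_const.mul (contDiffAt_abs hξ)).rpow_const_of_ne
      (mul_pos Real.two_pi_pos (abs_pos.2 hξ)).ne'

/-- The Schwartz function `annularCutoff n * w`. -/
noncomputable def annularMul (n : ℕ) (w : 𝓢(ℝ, ℂ)) : 𝓢(ℝ, ℂ) :=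
  HasCompactSupport.toSchwartzMap (f := fun ξ => (annularCutoff n ξ : ℂ) * w ξ)
    ((hasCompactSupport_annularCutoff n).comp_left Complex.ofReal_zero).mul_right
    ((Complex.ofRealCLM.contDiff.comp (contDiff_annularCutoff n)).mul (w.smooth ⊤))

/-- The Schwartz function `annularCutoff n * w / quarterSymbol`. -/
noncomputable def annularDiv (n : ℕ) (w : 𝓢(ℝ, ℂ)) : 𝓢(ℝ, ℂ) :=
  HasCompactSupport.toSchwartzMap
    (f := fun ξ => ((annularCutoff n ξ / quarterSymbol ξ : ℝ) : ℂ) * w ξ)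
    (((hasCompactSupport_annularCutoff n).mul_right (f' := fun ξ => (quarterSymbol ξ)⁻¹)).comp_left
      Complex.ofReal_zero).mul_right
    ((Complex.ofRealCLM.contDiff.comp (contDiff_div_quarterSymbol (contDiff_annularCutoff n)
      (annularCutoff_eventuallyEq_zero n))).mul (w.smooth ⊤))

lemma annularMul_apply (n : ℕ) (w : 𝓢(ℝ, ℂ)) (ξ : ℝ) :
    annularMul n w ξ = annularCutoff n ξ * w ξ := rfl

lemma annularDiv_apply (n : ℕ) (w : 𝓢(ℝ, ℂ)) (ξ : ℝ) :
    annularDiv n w ξ = ((annularCutoff n ξ / quarterSymbol ξ : ℝ) : ℂ) * w ξ := rfl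

lemma quarterSymbol_mul_annularDiv (n : ℕ) (w : 𝓢(ℝ, ℂ)) (ξ : ℝ) :
    (quarterSymbol ξ : ℂ) * annularDiv n w ξ = annularMul n w ξ := by
  rw [annularDiv_apply, annularMul_apply, ← mul_assoc, ← Complex.ofReal_mul]
  rcases eq_or_ne ξ 0 with rfl | hξ
  · simp [(annularCutoff_eventuallyEq_zero n).self_of_nhds]
  · rw [mul_div_cancel₀ _ (quarterSymbol_pos hξ).ne']

lemma ae_eventually_annularCutoff_eventuallyEq_one :
    ∀ᵐ ξ : ℝ, ∀ᶠ n in atTop, annularCutoff n =ᶠ[𝓝 ξ] 1 := by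
  filter_upwards [volume.ae_ne 0] with ξ hξ using eventually_annularCutoff_eventuallyEq_one hξ

lemma norm_one_sub_annularCutoff_mul_le (n : ℕ) (ξ : ℝ) (z : ℂ) :
    ‖(1 - (annularCutoff n ξ : ℂ)) * z‖ ≤ ‖z‖ := by
  obtain ⟨h0, h1⟩ := annularCutoff_mem_Icc n ξ
  rw [norm_mul, ← Complex.ofReal_one, ← Complex.ofReal_sub, Complex.norm_real,
    Real.norm_of_nonneg (sub_nonneg.2 h1)]
  exact mul_le_of_le_one_left (norm_nonneg _) (sub_le_self _ h0)

lemma sub_annularMul_apply (w : 𝓢(ℝ, ℂ)) (n : ℕ) (ξ : ℝ) :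
    (w - annularMul n w) ξ = (1 - (annularCutoff n ξ : ℂ)) * w ξ := by
  rw [sub_apply, annularMul_apply, one_sub_mul]

lemma deriv_sub_annularMul (w : 𝓢(ℝ, ℂ)) (n : ℕ) (ξ : ℝ) :
    deriv (w - annularMul n w : 𝓢(ℝ, ℂ)) ξ = (1 - (annularCutoff n ξ : ℂ)) * deriv w ξ
      - ((deriv (annularCutoff n) ξ : ℝ) : ℂ) * w ξ := by
  have hθ := ((contDiff_annularCutoff n).differentiable (by norm_num) ξ).hasDerivAt.ofReal_comp
  have h := (hθ.const_sub 1).mul (w.hasDerivAt ξ)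
  rw [show ⇑(w - annularMul n w) = fun ξ => (1 - (annularCutoff n ξ : ℂ)) * w ξ from
    funext (sub_annularMul_apply w n)]
  refine h.deriv.trans ?_
  ring

lemma tendsto_lintegral_fourier_sub_annularMul_zero {w : 𝓢(ℝ, ℂ)} {b : ℝ → ℝ} (hb : MemLp b 2)
    (hw : ∀ ξ, ‖w ξ‖ ≤ |ξ| * b ξ) :
    Tendsto (fun n => ∫⁻ x, ‖𝓕 ((w - annularMul n w : 𝓢(ℝ, ℂ)) : ℝ → ℂ) x‖ₑ) atTop (𝓝 0) := by
  have hw' : MemLp (fun ξ => ‖deriv w ξ‖) 2 := by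
    simpa only [SchwartzMap.derivCLM_apply] using ((SchwartzMap.derivCLM ℂ ℂ w).memLp 2).norm
  obtain ⟨K, hK⟩ := exists_abs_mul_deriv_annularCutoff_le
  -- The derivative of the cutoff is of order `1 / |ξ|`, which the vanishing of `w` at `0` absorbs.
  have hderiv (n : ℕ) (ξ : ℝ) : ‖((deriv (annularCutoff n) ξ : ℝ) : ℂ) * w ξ‖ ≤ K * ‖b ξ‖ := by
    rw [norm_mul, Complex.norm_real, Real.norm_eq_abs]
    calc |deriv (annularCutoff n) ξ| * ‖w ξ‖
        ≤ |deriv (annularCutoff n) ξ| * (|ξ| * ‖b ξ‖) := by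
          gcongr
          exact (hw ξ).trans (by gcongr; exact le_abs_self _)
      _ = |ξ * deriv (annularCutoff n) ξ| * ‖b ξ‖ := by rw [abs_mul]; ring
      _ ≤ K * ‖b ξ‖ := by
          gcongr
          exact hK n ξ
  refine tendsto_lintegral_enorm_fourier_zero
    (tendsto_lintegral_enorm_sq_zero (fun n => (SchwartzMap.continuous _).aestronglyMeasurable)
      (w.memLp 2).norm (fun n => ae_of_all _ fun ξ => ?_) ?_)
    (tendsto_lintegral_enorm_sq_zero (fun n => (measurable_deriv _).aestronglyMeasurable)
      (hw'.add (hb.norm.const_mul K)) (fun n => ae_of_all _ fun ξ => ?_) ?_)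
  · rw [sub_annularMul_apply]
    exact norm_one_sub_annularCutoff_mul_le n ξ (w ξ)
  · filter_upwards [ae_eventually_annularCutoff_eventuallyEq_one] with ξ hξ
    filter_upwards [hξ] with n hn
    rw [sub_annularMul_apply, hn.self_of_nhds]
    simp
  · rw [deriv_sub_annularMul]
    exact (norm_sub_le _ _).trans
      (add_le_add (norm_one_sub_annularCutoff_mul_le n ξ (deriv w ξ)) (hderiv n ξ))
  · filter_upwards [ae_eventually_annularCutoff_eventuallyEq_one] with ξ hξ
    filter_upwards [hξ] with n hn
    rw [deriv_sub_annularMul, hn.self_of_nhds, hn.deriv_eq]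
    simp

lemma tendsto_integral_bdd_mul {α ι : Type*} {mα : MeasurableSpace α} {μ : Measure α}
    {l : Filter ι} {F : α → ℂ} {B : ℝ} (hF : AEStronglyMeasurable F μ) (hB : ∀ᵐ x ∂μ, ‖F x‖ ≤ B)
    {w : ι → α → ℂ} {v : α → ℂ} (hw : ∀ i, Integrable (w i) μ) (hv : Integrable v μ)
    (h : Tendsto (fun i => ∫⁻ x, ‖v x - w i x‖ₑ ∂μ) l (𝓝 0)) :
    Tendsto (fun i => ∫ x, F x * w i x ∂μ) l (𝓝 (∫ x, F x * v x ∂μ)) := by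
  refine tendsto_integral_of_L1 _ (hv.bdd_mul hF hB).aestronglyMeasurable
    (Eventually.of_forall fun i => (hw i).bdd_mul hF hB) ?_
  have hbound := ENNReal.Tendsto.const_mul (a := ‖B‖ₑ) h (Or.inr enorm_ne_top)
  rw [mul_zero] at hbound
  refine tendsto_of_tendsto_of_tendsto_of_le_of_le tendsto_const_nhds hbound (fun _ => zero_le)
    fun i => ?_
  rw [← lintegral_const_mul' _ _ enorm_ne_top]
  refine lintegral_mono_ae ?_
  filter_upwards [hB] with x hx
  rw [← mul_sub, enorm_mul, enorm_sub_rev]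
  gcongr
  exact enorm_le_iff_norm_le.2 (hx.trans (le_abs_self B))

lemma tendsto_integral_mul_annularDiv (Γ : Lp ℂ 2 (volume : Measure ℝ)) (h : ℝ) (q : 𝓢(ℝ, ℂ)) :
    Tendsto (fun n => ∫ ξ, Γ ξ * annularDiv n (diffSymbolMul h q) ξ) atTop
      (𝓝 (∫ ξ, Γ ξ * (diffSymbol h ξ / quarterSymbol ξ) * q ξ)) := by
  have hfactor (n : ℕ) (ξ : ℝ) : annularDiv n (diffSymbolMul h q) ξ
      = annularCutoff n ξ * (diffSymbol h ξ / quarterSymbol ξ) * q ξ := by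
    rw [annularDiv_apply, diffSymbolMul_apply]
    push_cast
    ring
  refine tendsto_integral_of_dominated_convergence (fun ξ => √(2 * |h|) * ‖Γ ξ * q ξ‖)
    (fun n => (Lp.aestronglyMeasurable _).mul (SchwartzMap.continuous _).aestronglyMeasurable)
    (((Lp.memLp Γ).integrable_mul (q.memLp 2)).norm.const_mul _)
    (fun n => ae_of_all _ fun ξ => ?_) ?_
  · obtain ⟨h0, h1⟩ := annularCutoff_mem_Icc n ξ
    calc ‖Γ ξ * annularDiv n (diffSymbolMul h q) ξ‖
        = annularCutoff n ξ * ‖diffSymbol h ξ / quarterSymbol ξ‖ * ‖Γ ξ * q ξ‖ := by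
          rw [hfactor, norm_mul, norm_mul, norm_mul, norm_mul, Complex.norm_real,
            Real.norm_of_nonneg h0]
          ring
      _ ≤ 1 * √(2 * |h|) * ‖Γ ξ * q ξ‖ := by
          gcongr
          exact norm_diffSymbol_div_le h ξ
      _ = √(2 * |h|) * ‖Γ ξ * q ξ‖ := by rw [one_mul]
  · filter_upwards [ae_eventually_annularCutoff_eventuallyEq_one] with ξ hξ
    refine tendsto_const_nhds.congr' ?_
    filter_upwards [hξ] with n hn
    rw [hfactor, hn.self_of_nhds, Pi.one_apply, Complex.ofReal_one]
    ring

end DifferenceQuotient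

section GagliardoEnergy

variable {f g : ℝ → ℝ} {B : ℝ}

/-- The Fourier transform of `g = (-Δ)^{1/4} f`, as an element of `L²`. -/
noncomputable def IsQuarterLaplacian.fourierLp (H : IsQuarterLaplacian f g) :
    Lp ℂ 2 (volume : Measure ℝ) :=
  𝓕 ((H.memLp.ofReal (K := ℂ)).toLp _)

lemma IsQuarterLaplacian.integral_fourierLp_mul (H : IsQuarterLaplacian f g) (q : 𝓢(ℝ, ℂ)) :
    ∫ ξ, H.fourierLp ξ * q ξ = ∫ x, (g x : ℂ) * (𝓕 q) x := by
  rw [fourierLp, integral_fourier_Lp_mul]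
  refine integral_congr_ae ?_
  filter_upwards [(H.memLp.ofReal (K := ℂ)).coeFn_toLp] with x hx
  rw [hx]
  rfl

lemma IsQuarterLaplacian.lintegral_enorm_fourierLp_sq (H : IsQuarterLaplacian f g) :
    ∫⁻ ξ, ‖H.fourierLp ξ‖ₑ ^ 2 = ∫⁻ x, ‖g x‖ₑ ^ 2 := by
  rw [← enorm_Lp_two_sq, fourierLp, enorm_fourier_Lp, enorm_toLp_two_sq]
  exact lintegral_congr fun x => congrArg (· ^ 2) (enorm_ofReal (g x))

lemma IsQuarterLaplacian.integral_mul_fourier_annularMul (H : IsQuarterLaplacian f g) (n : ℕ)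
    (w : 𝓢(ℝ, ℂ)) :
    ∫ x, (f x : ℂ) * (𝓕 (annularMul n w)) x = ∫ ξ, H.fourierLp ξ * annularDiv n w ξ := by
  rw [H.integral_fourierLp_mul, ← H.integral_eq, quarterLaplacianSchwartz_eq,
    FourierTransform.fourierInv_fourier_eq, funext (quarterSymbol_mul_annularDiv n w),
    SchwartzMap.fourier_coe]

lemma IsQuarterLaplacian.integral_mul_fourier_diffSymbolMul (H : IsQuarterLaplacian f g)
    (hB : ∀ᵐ x, ‖f x‖ ≤ B) (h : ℝ) (q : 𝓢(ℝ, ℂ)) :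
    ∫ x, (f x : ℂ) * (𝓕 (diffSymbolMul h q)) x
      = ∫ ξ, H.fourierLp ξ * (diffSymbol h ξ / quarterSymbol ξ) * q ξ := by
  have hBc : ∀ᵐ x, ‖(f x : ℂ)‖ ≤ B := by simpa only [Complex.norm_real] using hB
  set w := diffSymbolMul h q
  have hw (ξ : ℝ) : ‖w ξ‖ ≤ |ξ| * (2 * Real.pi * |h| * ‖q ξ‖) := by
    rw [diffSymbolMul_apply, norm_mul]
    refine (mul_le_mul_of_nonneg_right (norm_diffSymbol_le h ξ) (norm_nonneg _)).trans_eq ?_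
    ring
  have hL1 := tendsto_lintegral_fourier_sub_annularMul_zero
    ((q.memLp 2).norm.const_mul (2 * Real.pi * |h|)) hw
  have hsub (n : ℕ) (x : ℝ) : 𝓕 ((w - annularMul n w : 𝓢(ℝ, ℂ)) : ℝ → ℂ) x
      = (𝓕 w) x - (𝓕 (annularMul n w)) x := by
    rw [← SchwartzMap.fourier_coe]
    exact DFunLike.congr_fun
      (map_sub (FourierTransform.fourierCLM ℂ 𝓢(ℝ, ℂ)) w (annularMul n w)) x
  simp only [hsub] at hL1
  refine tendsto_nhds_unique (tendsto_integral_bdd_mul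
    (Complex.continuous_ofReal.comp_aestronglyMeasurable H.locallyIntegrable.aestronglyMeasurable)
    hBc (fun n => (𝓕 (annularMul n w)).integrable)
    (𝓕 w).integrable hL1) ?_
  simp only [H.integral_mul_fourier_annularMul]
  exact tendsto_integral_mul_annularDiv H.fourierLp h q

lemma integral_sub_mul_eq_integral_mul_sub {F w : ℝ → ℂ} (hF : AEStronglyMeasurable F)
    (hB : ∀ᵐ x, ‖F x‖ ≤ B) (hw : Integrable w) (h : ℝ) :
    ∫ x, (F (x + h) - F x) * w x = ∫ x, F x * (w (x - h) - w x) := by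
  have hshift := measurePreserving_add_right (volume : Measure ℝ) h
  have htranslate : ∫ x, F (x + h) * w x = ∫ x, F x * w (x - h) := by
    rw [← integral_add_right_eq_self (fun x => F x * w (x - h)) h]
    simp only [add_sub_cancel_right]
  simp only [sub_mul, mul_sub]
  have hint : Integrable fun x => F (x + h) * w x :=
    hw.bdd_mul (hF.comp_measurePreserving hshift) (hshift.quasiMeasurePreserving.ae hB)
  rw [integral_sub hint (hw.bdd_mul hF hB),
    integral_sub ((hw.comp_sub_right h).bdd_mul hF hB) (hw.bdd_mul hF hB), htranslate]

lemma memLp_mul_diffSymbol_div (Γ : Lp ℂ 2 (volume : Measure ℝ)) (h : ℝ) :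
    MemLp (fun ξ => Γ ξ * (diffSymbol h ξ / quarterSymbol ξ)) 2 := by
  refine (Lp.memLp Γ).of_le_mul (c := √(2 * |h|))
    ((Lp.aestronglyMeasurable Γ).mul (measurable_diffSymbol_div h).aestronglyMeasurable)
    (ae_of_all _ fun ξ => ?_)
  rw [norm_mul, mul_comm]
  exact mul_le_mul_of_nonneg_right (norm_diffSymbol_div_le h ξ) (norm_nonneg _)

lemma IsQuarterLaplacian.sub_ae_eq_fourierInv (H : IsQuarterLaplacian f g)
    (hB : ∀ᵐ x, ‖f x‖ ≤ B) (h : ℝ) :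
    (fun x => ((f (x + h) - f x : ℝ) : ℂ)) =ᵐ[volume]
      (𝓕⁻ ((memLp_mul_diffSymbol_div H.fourierLp h).toLp _) : Lp ℂ 2 (volume : Measure ℝ)) := by
  have hBc : ∀ᵐ x, ‖(f x : ℂ)‖ ≤ B := by simpa only [Complex.norm_real] using hB
  have hf : MemLp f ⊤ := memLp_top_of_bound H.locallyIntegrable.aestronglyMeasurable B hB
  have hfc : AEStronglyMeasurable fun x => (f x : ℂ) := hf.ofReal.1
  have hloc : LocallyIntegrable fun x => ((f (x + h) - f x : ℝ) : ℂ) :=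
    ((hf.comp_measurePreserving (measurePreserving_add_right volume h)).sub
      hf).ofReal.locallyIntegrable le_top
  refine ae_eq_of_integral_mul_schwartz hloc ((Lp.memLp _).locallyIntegrable one_le_two)
    fun ψ _ => ?_
  obtain ⟨q, rfl⟩ : ∃ q : 𝓢(ℝ, ℂ), 𝓕 q = ψ := ⟨𝓕⁻ ψ, FourierTransform.fourier_fourierInv_eq ψ⟩
  have hfourier (x : ℝ) : (𝓕 q) (x - h) - (𝓕 q) x = (𝓕 (diffSymbolMul h q)) x := by
    simp only [SchwartzMap.fourier_coe]
    rw [funext (diffSymbolMul_apply h q), fourier_diffSymbol_mul q.integrable]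
  calc ∫ x, ((f (x + h) - f x : ℝ) : ℂ) * (𝓕 q) x
      = ∫ x, (f x : ℂ) * (𝓕 (diffSymbolMul h q)) x := by
        simp only [Complex.ofReal_sub]
        rw [integral_sub_mul_eq_integral_mul_sub hfc hBc (𝓕 q).integrable]
        simp only [hfourier]
    _ = ∫ ξ, H.fourierLp ξ * (diffSymbol h ξ / quarterSymbol ξ) * q ξ :=
        H.integral_mul_fourier_diffSymbolMul hB h q
    _ = ∫ ξ, (memLp_mul_diffSymbol_div H.fourierLp h).toLp _ ξ * q ξ := by
        refine integral_congr_ae ?_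
        filter_upwards [(memLp_mul_diffSymbol_div H.fourierLp h).coeFn_toLp] with ξ hξ
        rw [hξ]
    _ = _ := by rw [← integral_fourier_Lp_mul, FourierTransform.fourier_fourierInv_eq]

lemma IsQuarterLaplacian.lintegral_enorm_sub_sq (H : IsQuarterLaplacian f g)
    (hB : ∀ᵐ x, ‖f x‖ ≤ B) (h : ℝ) :
    ∫⁻ x, ‖f (x + h) - f x‖ₑ ^ 2
      = ∫⁻ ξ, ‖diffSymbol h ξ‖ₑ ^ 2 * (‖H.fourierLp ξ‖ₑ ^ 2 / ‖quarterSymbol ξ‖ₑ ^ 2) := by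
  set hN := memLp_mul_diffSymbol_div H.fourierLp h
  calc ∫⁻ x, ‖f (x + h) - f x‖ₑ ^ 2
      = ∫⁻ x, ‖(𝓕⁻ (hN.toLp _) : Lp ℂ 2 (volume : Measure ℝ)) x‖ₑ ^ 2 := by
        refine lintegral_congr_ae ?_
        filter_upwards [H.sub_ae_eq_fourierInv hB h] with x hx
        rw [← hx, enorm_ofReal]
    _ = ∫⁻ ξ, ‖H.fourierLp ξ * (diffSymbol h ξ / quarterSymbol ξ)‖ₑ ^ 2 := by
        rw [← enorm_Lp_two_sq, ← enorm_fourier_Lp, FourierTransform.fourier_fourierInv_eq,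
          enorm_toLp_two_sq]
    _ = _ := by
        refine lintegral_congr_ae ?_
        filter_upwards [volume.ae_ne 0] with ξ hξ
        have hσ : (quarterSymbol ξ : ℂ) ≠ 0 := Complex.ofReal_ne_zero.2 (quarterSymbol_pos hξ).ne'
        rw [div_eq_mul_inv, enorm_mul, enorm_mul, enorm_inv hσ, enorm_ofReal, mul_pow, mul_pow,
          ← ENNReal.inv_pow, div_eq_mul_inv, mul_left_comm]

lemma IsQuarterLaplacian.gagliardo_eq (H : IsQuarterLaplacian f g) (hB : ∀ᵐ x, ‖f x‖ ≤ B) :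
    ENNReal.ofReal (2 * Real.pi) * gagliardo f = kernelConst * ∫⁻ x, ‖g x‖ₑ ^ 2 := by
  have hmeas : AEMeasurable fun ξ => ‖H.fourierLp ξ‖ₑ ^ 2 / ‖quarterSymbol ξ‖ₑ ^ 2 :=
    ((Lp.aestronglyMeasurable _).enorm.pow_const 2).div
      (continuous_quarterSymbol.measurable.enorm.pow_const 2).aemeasurable
  rw [gagliardo_eq_of_lintegral_sub_sq hmeas (H.lintegral_enorm_sub_sq hB), mul_left_comm,
    ← lintegral_const_mul' _ _ ENNReal.ofReal_ne_top, ← H.lintegral_enorm_fourierLp_sq]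
  congr 1
  refine lintegral_congr_ae ?_
  filter_upwards [volume.ae_ne 0] with ξ hξ
  have hσ : ‖quarterSymbol ξ‖ₑ ^ 2 ≠ 0 := by simpa using (quarterSymbol_pos hξ).ne'
  rw [← mul_assoc, ← enorm_quarterSymbol_sq, ENNReal.mul_div_cancel hσ (by finiteness)]

lemma IsQuarterLaplacian.gagliardo_ne_top (H : IsQuarterLaplacian f g) (hB : ∀ᵐ x, ‖f x‖ ≤ B) :
    gagliardo f ≠ ⊤ := by
  refine (ENNReal.lt_top_of_mul_ne_top_right (a := ENNReal.ofReal (2 * Real.pi)) ?_ ?_).ne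
  · rw [H.gagliardo_eq hB]
    exact ENNReal.mul_ne_top kernelConst_ne_top
      ((memLp_two_iff_lintegral_ne_top H.memLp.1).1 H.memLp)
  · simpa using Real.pi_pos

end GagliardoEnergy

section WeakConvergence

lemma tendsto_inner_of_denseRange {𝕜 E X ι : Type*} [RCLike 𝕜] [NormedAddCommGroup E]
    [InnerProductSpace 𝕜 E] {l : Filter ι} {γ : ι → E} {γ₀ : E} {C : ℝ} (hC : ∀ i, ‖γ i‖ ≤ C)
    {e : X → E} (he : DenseRange e)
    (h : ∀ x, Tendsto (fun i => inner 𝕜 (γ i) (e x)) l (𝓝 (inner 𝕜 γ₀ (e x)))) (v : E) :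
    Tendsto (fun i => inner 𝕜 (γ i) v) l (𝓝 (inner 𝕜 γ₀ v)) := by
  have hlip (i : ι) : LipschitzWith C.toNNReal fun v => inner 𝕜 (γ i) v :=
    LipschitzWith.of_dist_le_mul fun v w => by
      rw [dist_eq_norm, dist_eq_norm, ← inner_sub_right]
      exact (norm_inner_le_norm _ _).trans
        (mul_le_mul_of_nonneg_right ((hC i).trans (Real.le_coe_toNNReal C)) (norm_nonneg _))
  exact he.induction_on (p := fun v => Tendsto (fun i => inner 𝕜 (γ i) v) l (𝓝 (inner 𝕜 γ₀ v))) v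
    ((LipschitzWith.uniformEquicontinuous _ _ hlip).equicontinuous.isClosed_setOfPred_tendsto
      (by fun_prop)) h

lemma inner_toLp_ofReal {α : Type*} {mα : MeasurableSpace α} {μ : Measure α} {a : α → ℝ}
    {b : α → ℂ} (ha : MemLp a 2 μ) (hb : MemLp b 2 μ) :
    inner ℂ ((ha.ofReal (K := ℂ)).toLp _) (hb.toLp b) = ∫ x, (a x : ℂ) * b x ∂μ := by
  rw [L2.inner_def]
  refine integral_congr_ae ?_
  filter_upwards [(ha.ofReal (K := ℂ)).coeFn_toLp, hb.coeFn_toLp] with x h₁ h₂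
  rw [h₁, h₂, RCLike.inner_apply, RCLike.conj_ofReal, mul_comm]
  rfl

variable {V : Type*} [NormedAddCommGroup V] [InnerProductSpace ℝ V] [FiniteDimensional ℝ V]
  [MeasurableSpace V] [BorelSpace V]

lemma tendsto_integral_mul_of_tendsto_schwartz {ι : Type*} {l : Filter ι} {g : ι → V → ℝ}
    {g₀ G : V → ℝ} (hg : ∀ i, MemLp (g i) 2) (hg₀ : MemLp g₀ 2) (hG : MemLp G 2)
    {C : ℝ≥0∞} (hC : C ≠ ⊤) (hgC : ∀ i, ∫⁻ x, ‖g i x‖ₑ ^ 2 ≤ C)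
    (hlim : ∀ ψ : 𝓢(V, ℂ), Tendsto (fun i => ∫ x, (g i x : ℂ) * ψ x) l
      (𝓝 (∫ x, (g₀ x : ℂ) * ψ x))) :
    Tendsto (fun i => ∫ x, G x * g i x) l (𝓝 (∫ x, G x * g₀ x)) := by
  have hbound (i : ι) : ‖((hg i).ofReal (K := ℂ)).toLp _‖ ≤ √C.toReal := by
    refine Real.le_sqrt_of_sq_le ?_
    rw [← toReal_enorm, ← ENNReal.toReal_pow, enorm_toLp_two_sq]
    refine ENNReal.toReal_mono hC (le_trans (lintegral_congr fun x => ?_).le (hgC i))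
    exact congrArg (· ^ 2) (enorm_ofReal (g i x))
  have htest {a : V → ℝ} (ha : MemLp a 2) (ψ : 𝓢(V, ℂ)) :
      inner ℂ ((ha.ofReal (K := ℂ)).toLp _) (SchwartzMap.toLpCLM ℂ ℂ 2 volume ψ)
        = ∫ x, (a x : ℂ) * ψ x :=
    inner_toLp_ofReal ha (ψ.memLp 2)
  have hinner := tendsto_inner_of_denseRange (𝕜 := ℂ) (l := l)
    (γ₀ := (hg₀.ofReal (K := ℂ)).toLp _) hbound (e := SchwartzMap.toLpCLM ℂ ℂ 2 volume)
    (SchwartzMap.denseRange_toLpCLM ENNReal.ofNat_ne_top)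
    (fun ψ => by simpa only [htest (hg _), htest hg₀] using hlim ψ) ((hG.ofReal (K := ℂ)).toLp _)
  have hpair {a : V → ℝ} (ha : MemLp a 2) :
      (inner ℂ ((ha.ofReal (K := ℂ)).toLp _) ((hG.ofReal (K := ℂ)).toLp _)).re
        = ∫ x, G x * a x := by
    rw [inner_toLp_ofReal ha hG.ofReal]
    simp only [RCLike.ofReal_eq_complex_ofReal, ← Complex.ofReal_mul]
    rw [integral_complex_ofReal, Complex.ofReal_re]
    simp only [mul_comm]
  simpa only [Function.comp_def, hpair (hg _), hpair hg₀]
    using (Complex.continuous_re.tendsto _).comp hinner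

lemma MemHomHalf.tendsto_halfLaplacian {v f₀ : ℝ → ℝ} {f : ℕ → ℝ → ℝ} {B : ℝ} {C : ℝ≥0∞}
    (hv : MemHomHalf v) (hf : ∀ n, MemHomHalf (f n)) (hf₀ : MemHomHalf f₀)
    (hB : ∀ᵐ x, ‖f₀ x‖ ≤ B) (hdom : ∀ n x, ‖f n x‖ ≤ ‖f₀ x‖) (hC : C ≠ ⊤)
    (hfC : ∀ n, gagliardo (f n) ≤ C) (hlim : ∀ᵐ x, Tendsto (f · x) atTop (𝓝 (f₀ x))) :
    Tendsto (fun n => halfLaplacian v (f n)) atTop (𝓝 (halfLaplacian v f₀)) := by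
  have henergy (n : ℕ) : ∫⁻ x, ‖quarterLaplacian (f n) x‖ₑ ^ 2
      ≤ ENNReal.ofReal (2 * Real.pi) * C / kernelConst := by
    rw [ENNReal.le_div_iff_mul_le (Or.inl kernelConst_ne_zero) (Or.inl kernelConst_ne_top),
      mul_comm, ← (hf n).isQuarterLaplacian.gagliardo_eq (hB.mono fun x hx => (hdom n x).trans hx)]
    gcongr
    exact hfC n
  refine tendsto_integral_mul_of_tendsto_schwartz (fun n => (hf n).isQuarterLaplacian.memLp)
    hf₀.isQuarterLaplacian.memLp hv.isQuarterLaplacian.memLp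
    (ENNReal.div_ne_top (by finiteness) kernelConst_ne_zero) henergy fun ψ => ?_
  simp only [← hf₀.isQuarterLaplacian.integral_eq ψ, ← (hf _).isQuarterLaplacian.integral_eq ψ]
  refine tendsto_integral_of_dominated_convergence _
    (fun n => ((hf n).isQuarterLaplacian.integrable ψ).aestronglyMeasurable)
    (hf₀.isQuarterLaplacian.integrable ψ).norm (fun n => ae_of_all _ fun x => ?_) ?_
  · rw [norm_mul, norm_mul, Complex.norm_real, Complex.norm_real]
    exact mul_le_mul_of_nonneg_right (hdom n x) (norm_nonneg _)
  · filter_upwards [hlim] with x hx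
    exact ((Complex.continuous_ofReal.tendsto _).comp hx).mul_const _

end WeakConvergence

section Removability

variable {f φ : ℝ → ℝ} {B : ℝ}

lemma memLp_mul_of_bounded (hf : AEStronglyMeasurable f) (hB : ∀ᵐ x, ‖f x‖ ≤ B)
    (hφ : Continuous φ) (hc : HasCompactSupport φ) (p : ℝ≥0∞) :
    MemLp (fun x => f x * φ x) p := by
  refine (hφ.memLp_of_hasCompactSupport (p := p) (μ := volume) hc).of_le_mul (c := B)
    (hf.mul hφ.aestronglyMeasurable) ?_
  filter_upwards [hB] with x hx
  rw [norm_mul]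
  exact mul_le_mul_of_nonneg_right hx (norm_nonneg _)

lemma MemHomHalf.mul_contDiff (hf : MemHomHalf f) (hB : ∀ᵐ x, ‖f x‖ ≤ B) (hφ : ContDiff ℝ ∞ φ)
    (hc : HasCompactSupport φ) : MemHomHalf fun x => f x * φ x := by
  obtain ⟨M, hM⟩ := hc.exists_bound_of_continuous hφ.continuous
  have hmem := memLp_mul_of_bounded hf.isQuarterLaplacian.locallyIntegrable.aestronglyMeasurable hB
    hφ.continuous hc
  refine memHomHalf_of_gagliardo_ne_top (memLp_one_iff_integrable.1 (hmem 1)) (hmem 2)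
    (ne_top_of_le_ne_top ?_ (gagliardo_mul_le hB hφ.continuous hM))
  have := hf.isQuarterLaplacian.gagliardo_ne_top hB
  have := gagliardo_ne_top_of_contDiff hφ hc
  finiteness

/-- A smooth cutoff vanishing near every point of `A` and equal to `1` at distance at least
`2 / (n + 1)` from `A`. -/
noncomputable def puncturedCutoff (A : Finset ℝ) (n : ℕ) (x : ℝ) : ℝ :=
  ∏ a ∈ A, (1 - bump (((n : ℝ) + 1) * (x - a)))

lemma contDiff_puncturedCutoff (A : Finset ℝ) (n : ℕ) : ContDiff ℝ ∞ (puncturedCutoff A n) :=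
  contDiff_prod fun _ _ => contDiff_const.sub
    (bump.contDiff.comp (contDiff_const.mul (contDiff_id.sub contDiff_const)))

lemma norm_one_sub_bump_le (t : ℝ) : ‖1 - bump t‖ ≤ 1 := by
  rw [Real.norm_of_nonneg (sub_nonneg.2 bump.le_one)]
  exact sub_le_self _ bump.nonneg

lemma norm_puncturedCutoff_le (A : Finset ℝ) (n : ℕ) (x : ℝ) : ‖puncturedCutoff A n x‖ ≤ 1 := by
  rw [puncturedCutoff, norm_prod]
  exact Finset.prod_le_one (fun _ _ => norm_nonneg _) fun _ _ => norm_one_sub_bump_le _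

lemma norm_mul_puncturedCutoff_le (A : Finset ℝ) (n : ℕ) (r x : ℝ) :
    ‖r * puncturedCutoff A n x‖ ≤ ‖r‖ :=
  (norm_mul _ _).trans_le (mul_le_of_le_one_right (norm_nonneg _) (norm_puncturedCutoff_le A n x))

lemma puncturedCutoff_eventuallyEq_zero {A : Finset ℝ} {a : ℝ} (ha : a ∈ A) (n : ℕ) :
    puncturedCutoff A n =ᶠ[𝓝 a] 0 := by
  have hcont : Continuous fun x : ℝ => |((n : ℝ) + 1) * (x - a)| := by fun_prop
  have hsmall : ∀ᶠ x : ℝ in 𝓝 a, |((n : ℝ) + 1) * (x - a)| < 1 :=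
    (hcont.tendsto a).eventually_lt_const (by simp)
  filter_upwards [hsmall] with x hx
  exact Finset.prod_eq_zero ha (by rw [bump_eq_one hx.le, sub_self])

lemma ae_eventually_puncturedCutoff_eq_one (A : Finset ℝ) :
    ∀ᵐ x, ∀ᶠ n in atTop, puncturedCutoff A n x = 1 := by
  filter_upwards [compl_mem_ae_iff.2 (A.finite_toSet.measure_zero volume)] with x hx
  have hfactor (a : ℝ) (ha : a ∈ A) :
      ∀ᶠ n : ℕ in atTop, 1 - bump (((n : ℝ) + 1) * (x - a)) = 1 := by
    have hdist : 0 < |x - a| := abs_pos.2 (sub_ne_zero.2 fun h => hx (h ▸ ha))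
    have hlim : Tendsto (fun n : ℕ => ((n : ℝ) + 1) * |x - a|) atTop atTop :=
      (tendsto_atTop_add_const_right _ _ tendsto_natCast_atTop_atTop).atTop_mul_const hdist
    filter_upwards [hlim.eventually_ge_atTop 2] with n hn
    rw [bump_eq_zero, sub_zero]
    rwa [abs_mul, abs_of_pos n.cast_add_one_pos]
  filter_upwards [(eventually_all_finset A).2 hfactor] with n hn
  exact Finset.prod_eq_one hn

lemma exists_gagliardo_mul_puncturedCutoff_le (hfin : gagliardo f ≠ ⊤) (hB : ∀ᵐ x, ‖f x‖ ≤ B)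
    (A : Finset ℝ) :
    ∃ C : ℝ≥0∞, C ≠ ⊤ ∧ ∀ n, gagliardo (fun x => f x * puncturedCutoff A n x) ≤ C := by
  induction A using Finset.induction_on with
  | empty => exact ⟨gagliardo f, hfin, fun n => by simp [puncturedCutoff]⟩
  | insert a A ha ih =>
    obtain ⟨C, hC, hCn⟩ := ih
    have hbump := gagliardo_ne_top_of_contDiff bump.contDiff bump.hasCompactSupport
    refine ⟨2 * (‖(1 : ℝ)‖ₑ ^ 2 * C + ‖B‖ₑ ^ 2 * gagliardo bump), by finiteness, fun n => ?_⟩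
    have hfactor (x : ℝ) : f x * puncturedCutoff (insert a A) n x
        = f x * puncturedCutoff A n x * (1 - bump (((n : ℝ) + 1) * (x - a))) := by
      rw [puncturedCutoff, Finset.prod_insert ha, puncturedCutoff]
      ring
    have hscale : gagliardo (fun x => 1 - bump (((n : ℝ) + 1) * (x - a))) = gagliardo bump := by
      rw [gagliardo_const_sub, gagliardo_comp_mul_sub _ n.cast_add_one_ne_zero]
    have hcont : Continuous fun x => 1 - bump (((n : ℝ) + 1) * (x - a)) := by
      have := bump.continuous
      fun_prop
    rw [funext hfactor]
    refine (gagliardo_mul_le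
      (hB.mono fun x hx => (norm_mul_puncturedCutoff_le A n (f x) x).trans hx) hcont
      fun x => norm_one_sub_bump_le _).trans ?_
    rw [hscale]
    gcongr
    exact hCn n

lemma tsupport_mul_puncturedCutoff_subset (φ : ℝ → ℝ) (A : Finset ℝ) (n : ℕ) :
    tsupport (fun x => φ x * puncturedCutoff A n x) ⊆ puncturedLine A := by
  intro a ha haA
  refine (notMem_tsupport_iff_eventuallyEq.2 ?_) ha
  filter_upwards [puncturedCutoff_eventuallyEq_zero haA n] with x hx
  simp [hx]

/-- The test function `φ * puncturedCutoff A n`, supported away from `A`. -/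
noncomputable def puncturedTestFunction (A : Finset ℝ) (n : ℕ) (φ : 𝓓((⊤ : Opens ℝ), ℝ)) :
    𝓓(puncturedLine A, ℝ) :=
  ⟨fun x => φ x * puncturedCutoff A n x, φ.contDiff.mul (contDiff_puncturedCutoff A n),
    φ.hasCompactSupport.mul_right, tsupport_mul_puncturedCutoff_subset φ A n⟩

lemma MemHomHalf.tendsto_halfLaplacian_puncturedTestFunction {v : ℝ → ℝ} (hv : MemHomHalf v)
    (hf : MemHomHalf f) (hB : ∀ᵐ x, ‖f x‖ ≤ B) (A : Finset ℝ) (φ : 𝓓((⊤ : Opens ℝ), ℝ)) :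
    Tendsto (fun n => halfLaplacian v (fun x => f x * puncturedTestFunction A n φ x)) atTop
      (𝓝 (halfLaplacian v (fun x => f x * φ x))) := by
  obtain ⟨M, hM⟩ := φ.hasCompactSupport.exists_bound_of_continuous φ.contDiff.continuous
  have hfφ := hf.mul_contDiff hB φ.contDiff φ.hasCompactSupport
  have hbound : ∀ᵐ x, ‖f x * φ x‖ ≤ B * M := by
    filter_upwards [hB] with x hx
    exact (norm_mul _ _).trans_le
      (mul_le_mul hx (hM x) (norm_nonneg _) ((norm_nonneg _).trans hx))
  obtain ⟨C, hC, hCn⟩ := exists_gagliardo_mul_puncturedCutoff_le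
    (hfφ.isQuarterLaplacian.gagliardo_ne_top hbound) hbound A
  have happly (n : ℕ) (x : ℝ) :
      f x * puncturedTestFunction A n φ x = f x * φ x * puncturedCutoff A n x :=
    (mul_assoc _ _ _).symm
  refine hv.tendsto_halfLaplacian (fun n => hf.mul_contDiff hB
    (puncturedTestFunction A n φ).contDiff (puncturedTestFunction A n φ).hasCompactSupport)
    hfφ hbound (fun n x => ?_) hC (fun n => ?_) ?_
  · rw [happly]
    exact norm_mul_puncturedCutoff_le A n _ x
  · simpa only [happly] using hCn n
  · filter_upwards [ae_eventually_puncturedCutoff_eq_one A] with x hx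
    refine tendsto_const_nhds.congr' ?_
    filter_upwards [hx] with n hn
    rw [happly, hn, mul_one]

end Removability

end HalfHarmonic

theorem proposition2p2_general {m : ℕ} {u : ℝ → EuclideanSpace ℝ (Fin m)} {A : Finset ℝ} {B : ℝ}
    (hu : ∀ i, HalfHarmonic.MemHomHalf (fun x => u x i)) (hB : ∀ᵐ x, ‖u x‖ ≤ B)
    (hA : HalfHarmonic.IsHalfHarmonicOn u (HalfHarmonic.puncturedLine A)) :
    (∀ φ : 𝓓((⊤ : Opens ℝ), ℝ), ∀ i : Fin m,
      HalfHarmonic.MemHomHalf (fun x => u x i * φ x)) ∧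
    HalfHarmonic.IsHalfHarmonicOn u ⊤ := by
  have hBi (i : Fin m) : ∀ᵐ x, ‖u x i‖ ≤ B :=
    hB.mono fun x hx => (PiLp.norm_apply_le (u x) i).trans hx
  refine ⟨fun φ i => (hu i).mul_contDiff (hBi i) φ.contDiff φ.hasCompactSupport, fun φ i j => ?_⟩
  have hlim : Filter.Tendsto
      (fun n => HalfHarmonic.wedgeHalfLaplacian u i j (HalfHarmonic.puncturedTestFunction A n φ))
      Filter.atTop (nhds (HalfHarmonic.wedgeHalfLaplacian u i j φ)) :=
    ((hu j).tendsto_halfLaplacian_puncturedTestFunction (hu i) (hBi i) A φ).sub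
      ((hu i).tendsto_halfLaplacian_puncturedTestFunction (hu j) (hBi j) A φ)
  simp only [hA _ i j] at hlim
  exact tendsto_nhds_unique hlim tendsto_const_nhds

theorem proposition2p2 {m : ℕ} (u : ℝ → EuclideanSpace ℝ (Fin m)) (A : Finset ℝ)
    (hu : HalfHarmonic.MemHomHalfSphere u)
    (hA : HalfHarmonic.IsHalfHarmonicOn u (HalfHarmonic.puncturedLine A)) :
    (∀ φ : 𝓓((⊤ : Opens ℝ), ℝ), ∀ i : Fin m,
      HalfHarmonic.MemHomHalf (fun x => u x i * φ x)) ∧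
    HalfHarmonic.IsHalfHarmonicOn u ⊤ :=
  proposition2p2_general hu.memHomHalf
    (hu.mem_sphere.mono fun _ hx => (mem_sphere_zero_iff_norm.1 hx).le) hA
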